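/- **Setting.** Let $p\ge 1$ and let $\mathbb S^p$ be the space of real symmetric $p\times p$ matrices; all real matrix spaces carry the trace inner product and the Frobenius norm $\|\cdot\|_F$, while $\|\cdot\|$ is the spectral norm. For a Euclidean space $E$ and $h:E\to(-\infty,\infty]$ finite at $x$, the regular subdifferential $\widehat\partial h(x)$ is the set of $v$ with $h(x')\ge h(x)+\langle v,x'-x\rangle+o(\|x'-x\|)$ as $x'\to x$, and the limiting subdifferential $\partial h(x)$ is the set of limits of $v^k\in\widehat\partial h(x^k)$ with $x^k\to x$, $h(x^k)\to h(x)$ (both are empty where $h$ is not finite); $\operatorname{crit}h=\{x: 0\in\partial h(x)\}$, and $\mathcal N_\Delta(x)=\partial\delta_\Delta(x)$ where $\delta_\Delta$ is the indicator function of $\Delta$ ($0$ on $\Delta$, $+\infty$ elsewhere; so $\mathcal N_\Delta(x)=\emptyset$ for $x\notin\Delta$). Put $$\Omega=\{X\in\mathbb S^p_+:\operatorname{diag}(X)=e\},\quad \mathcal R=\{X\in\mathbb S^p:\operatorname{rank}X\le1\},\quad \mathcal F=\{X\in\Omega:\langle I,X\rangle-\|X\|=0\},$$ where $\mathbb S^p_+$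 is the set of positive semidefinite matrices and $e$ the all-ones vector. Let $\psi(X)=-\|X\|$ on $\mathbb S^p$. Let $f:\mathbb S^p\to\mathbb R$ be continuously differentiable, let $\alpha_f\ge0$ be a Lipschitz constant of $f$ on $\Omega$, and $\rho^*=(1+2p)\alpha_f$. For $\rho>0$ put $\Phi_\rho(X)=f(X)+\rho(\langle I,X\rangle-\|X\|)+\delta_\Omega(X)$. For an integer $m$ with $1<m<p$ let $\mathcal S$ be the set of $V\in\mathbb R^{m\times p}$ all of whose columns have Euclidean norm $1$, and put $\widetilde f(V)=f(V^{\mathsf T}V)$, $\widetilde\psi(V)=\psi(V^{\mathsf T}V)$. Define the stationary point sets $$\widehat{\mathcal F}=\{X\in\mathbb S^p:0\in\nabla f(X)+\mathcal N_{\mathcal F}(X)\},\qquad \widehat\Omega_\rho=\{X\in\mathbb S^p:0\in\nabla f(X)+\rho[I+\partial\psi(X)]+\mathcal N_\Omega(X)\},$$ $$\widehat{\mathcal S}_\rho=\{V\in\mathbb R^{m\times p}:0\in\nabla\widetilde f(V)+\rho(2V+\partial\widetilde\psi(V))+\mathcal N_{\mathcal S}(V)\}$$ of, respectively, the DC-constrained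 problem $\min_{X\in\mathcal F}f(X)$, the penalty problem $\min_{X\in\Omega}\{f(X)+\rho(\langle I,X\rangle-\|X\|)\}$ and the factorized problem $\min_{V\in\mathcal S}\{\widetilde f(V)+\rho(\|V\|_F^2-\|V\|^2)\}$. **Proposition.** (i) $\mathcal F=\widehat{\mathcal F}=\{X\in\mathbb S^p: 0\in\nabla f(X)+\mathcal N_\Omega(X)+\mathcal N_{\mathcal R}(X)\}$. (ii) For every $\rho>0$, $\operatorname{crit}\Phi_\rho\subseteq\widehat\Omega_\rho$; and every rank-one $X\in\widehat\Omega_\rho$ (for any $\rho>0$) is a strictly local minimizer of the penalty problem associated with each $\rho'>\rho^*$. (iii) Each $X\in\mathcal F$ has a neighborhood $U$ such that, for every $\rho>\rho^*$, every $Z\in\widehat\Omega_\rho\cap U$ with $f(Z)+\rho(\langle I,Z\rangle-\|Z\|)\le\Phi_\rho(X)$ has rank one. (iv) Let $1<m<p$ and $\rho>0$. If $X\in\widehat\Omega_\rho$ has rank at most $m$, $\lambda_1(X)\ge\dots\ge\lambda_p(X)$ are its eigenvalues, $P$ is any orthogonal matrix with $X=P\operatorname{Diag}(\lambda_1(X),\dots,\lambda_p(X))P^{\mathsf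 T}$, $P_I$ consists of the first $m$ columns of $P$, and $\Lambda=\operatorname{Diag}(\lambda_1(X),\dots,\lambda_m(X))$, then $\sqrt\Lambda P_I^{\mathsf T}\in\widehat{\mathcal S}_\rho$. Conversely, let $V\in\widehat{\mathcal S}_\rho$. Then $V$ has multiplier pairs, i.e. pairs $(W,y)\in\partial\psi(V^{\mathsf T}V)\times\mathbb R^p$ with $V[\nabla f(V^{\mathsf T}V)+\rho(I+W)+\operatorname{Diag}(y)]=0$; and if some multiplier pair $(W,y)$ of $V$ satisfies $\nabla f(V^{\mathsf T}V)+\rho(I+W)+\operatorname{Diag}(y)\in\mathbb S^p_+$, then $V^{\mathsf T}V\in\widehat\Omega_\rho$. -/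

import Mathlib

open scoped NNReal Topology Gradient Pointwise

namespace DCSDP

/-- `ℝ^{m × p}` with the trace inner product and the Frobenius norm, as the Euclidean space of
the families of entries; `mat` and `ofMat` pass to matrices and back. -/
abbrev RMat (m p : ℕ) : Type := EuclideanSpace ℝ (Fin m × Fin p)

/-- The matrix of an element of `ℝ^{m × p}`. -/
def mat {m p : ℕ} (V : RMat m p) : Matrix (Fin m) (Fin p) ℝ := Matrix.of fun i j => V (i, j)

/-- The element of `ℝ^{m × p}` given by a matrix. -/
def ofMat {m p : ℕ} (A : Matrix (Fin m) (Fin p) ℝ) : RMat m p :=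
  WithLp.toLp 2 fun ij => A ij.1 ij.2

@[simp] theorem mat_apply {m p : ℕ} (V : RMat m p) (i : Fin m) (j : Fin p) :
    mat V i j = V (i, j) := rfl

@[simp] theorem mat_ofMat {m p : ℕ} (A : Matrix (Fin m) (Fin p) ℝ) : mat (ofMat A) = A := rfl

/-- The inner product is the trace inner product. -/
theorem inner_eq_trace {m p : ℕ} (A B : RMat m p) :
    inner ℝ A B = ((mat A).transpose * mat B).trace := by
  simp only [PiLp.inner_apply, Matrix.trace, Matrix.diag, Matrix.mul_apply,
    Matrix.transpose_apply, mat_apply, Fintype.sum_prod_type]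
  rw [Finset.sum_comm]
  simp [mul_comm]

/-- `𝕊^p`: the Euclidean space of real symmetric `p × p` matrices. -/
def Sym (p : ℕ) : Submodule ℝ (RMat p p) where
  carrier := {X | (mat X).IsSymm}
  add_mem' := fun {_ _} hA hB => Matrix.IsSymm.add hA hB
  zero_mem' := Matrix.isSymm_zero
  smul_mem' := fun c _ hA => Matrix.IsSymm.smul hA c

/-- The matrix of an element of `𝕊^p`. -/
abbrev smat {p : ℕ} (X : Sym p) : Matrix (Fin p) (Fin p) ℝ := mat (X : RMat p p)

/-- A symmetric matrix as an element of `𝕊^p`. -/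
def mkSym {p : ℕ} (A : Matrix (Fin p) (Fin p) ℝ) (hA : A.IsSymm) : Sym p := ⟨ofMat A, hA⟩

/-- The identity matrix. -/
def idMat (p : ℕ) : Sym p := mkSym 1 Matrix.isSymm_one

/-- `Diag y`. -/
def diagMat {p : ℕ} (y : Fin p → ℝ) : Sym p :=
  mkSym (Matrix.diagonal y) (Matrix.isSymm_diagonal y)

/-- `VᵀV`. -/
def gram {m p : ℕ} (V : RMat m p) : Sym p :=
  mkSym ((mat V).transpose * mat V) (by simp [Matrix.IsSymm, Matrix.transpose_mul])

section Variational

variable {E : Type*} [NormedAddCommGroup E] [InnerProductSpace ℝ E]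

/-- The regular (Fréchet) subdifferential: `h x' ≥ h x + ⟪v, x' - x⟫ + o(‖x' - x‖)`;
it is empty where `h` is not finite. -/
def regSubdiff (h : E → EReal) (x : E) : Set E :=
  {v | h x ≠ ⊤ ∧ h x ≠ ⊥ ∧ ∀ ε : ℝ, 0 < ε → ∀ᶠ x' in 𝓝 x,
    h x + ((inner ℝ v (x' - x) - ε * ‖x' - x‖ : ℝ) : EReal) ≤ h x'}

/-- The limiting (basic) subdifferential; it is empty where `h` is not finite. -/
def limSubdiff (h : E → EReal) (x : E) : Set E :=
  {v | h x ≠ ⊤ ∧ h x ≠ ⊥ ∧ ∃ (xs vs : ℕ → E),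
    Filter.Tendsto xs Filter.atTop (𝓝 x) ∧
    Filter.Tendsto (fun k => h (xs k)) Filter.atTop (𝓝 (h x)) ∧
    (∀ k, vs k ∈ regSubdiff h (xs k)) ∧
    Filter.Tendsto vs Filter.atTop (𝓝 v)}

/-- The critical points of `h`. -/
def crit (h : E → EReal) : Set E := {x | (0 : E) ∈ limSubdiff h x}

open Classical in
/-- The indicator function `δ_Δ`. -/
noncomputable def indicatorFn (Δ : Set E) (x : E) : EReal := if x ∈ Δ then 0 else ⊤

/-- The (limiting) normal cone to `Δ` at `x`; it is empty for `x ∉ Δ`. -/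
noncomputable def normalCone (Δ : Set E) (x : E) : Set E := limSubdiff (indicatorFn Δ) x

/-- `x` is a strictly local minimizer of `g` over `Δ`. -/
def IsStrictLocalMinimizer (g : E → ℝ) (Δ : Set E) (x : E) : Prop :=
  x ∈ Δ ∧ ∀ᶠ z in 𝓝 x, z ∈ Δ → z ≠ x → g x < g z

end Variational

section Problem

variable {m p : ℕ}

/-- The spectral norm of a symmetric matrix. -/
noncomputable def specNorm (X : Sym p) : ℝ := ‖Matrix.toEuclideanCLM (𝕜 := ℝ) (smat X)‖

/-- `Ω`: the positive semidefinite matrices with unit diagonal. -/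
def Omega (p : ℕ) : Set (Sym p) := {X | (smat X).PosSemidef ∧ ∀ i, smat X i i = 1}

/-- `𝓡`: the symmetric matrices of rank at most one. -/
def rankLeOne (p : ℕ) : Set (Sym p) := {X | (smat X).rank ≤ 1}

/-- `𝓕`: the feasible set of the DC-constrained problem. -/
def feasible (p : ℕ) : Set (Sym p) :=
  {X | inner ℝ (idMat p) X - specNorm X = 0 ∧ (∀ i, smat X i i = 1) ∧ (smat X).PosSemidef}

/-- `𝓢`: the matrices in `ℝ^{m × p}` all of whose columns have Euclidean norm one. -/
def unitCols (m p : ℕ) : Set (RMat m p) :=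
  {V | ∀ j, ‖WithLp.toLp 2 (fun i => V (i, j))‖ = 1}

/-- `ψ(Z) = -‖Z‖`. -/
noncomputable def psi (X : Sym p) : EReal := ((-specNorm X : ℝ) : EReal)

/-- `ψ̃(V) = ψ(VᵀV)`. -/
noncomputable def psiTilde (V : RMat m p) : EReal := psi (gram V)

/-- The objective function of the penalty problem. -/
noncomputable def penObj (f : Sym p → ℝ) (ρ : ℝ) (X : Sym p) : ℝ :=
  f X + ρ * (inner ℝ (idMat p) X - specNorm X)

/-- `Φ_ρ`: the objective function of the penalty problem plus the indicator of `Ω`. -/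
noncomputable def Phi (f : Sym p → ℝ) (ρ : ℝ) (X : Sym p) : EReal :=
  (penObj f ρ X : EReal) + indicatorFn (Omega p) X

/-- The stationary points of the DC-constrained problem. -/
def statDC (f : Sym p → ℝ) : Set (Sym p) :=
  {X | (0 : Sym p) ∈ {∇ f X} + normalCone (feasible p) X}

/-- The stationary points of the penalty problem. -/
def statPen (f : Sym p → ℝ) (ρ : ℝ) : Set (Sym p) :=
  {X | (0 : Sym p) ∈ {∇ f X} + ρ • ({idMat p} + limSubdiff psi X) + normalCone (Omega p) X}

/-- The stationary points of the factorized problem. -/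
def statFac (m : ℕ) (f : Sym p → ℝ) (ρ : ℝ) : Set (RMat m p) :=
  {V | (0 : RMat m p) ∈
    {∇ (fun U : RMat m p => f (gram U)) V}
      + ρ • ({(2 : ℝ) • V} + limSubdiff psiTilde V) + normalCone (unitCols m p) V}

theorem smat_isHermitian (X : Sym p) : (smat X).IsHermitian := by
  have h : (smat X).transpose = smat X := X.2
  rw [Matrix.IsHermitian, Matrix.conjTranspose_eq_transpose_of_trivial, h]

/-- `λ₁(X) ≥ ⋯ ≥ λ_p(X)`: the eigenvalues in nonincreasing order, with multiplicity. -/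
noncomputable def eigval (X : Sym p) (i : Fin p) : ℝ :=
  (smat_isHermitian X).eigenvalues₀ (i.cast (Fintype.card_fin p).symm)

/-- `𝕆(X)`: the orthogonal matrices `P` with `X = P Diag(λ(X)) Pᵀ`. -/
def eigBases (X : Sym p) : Set (Matrix (Fin p) (Fin p) ℝ) :=
  {P | P ∈ Matrix.orthogonalGroup (Fin p) ℝ ∧
    smat X = P * Matrix.diagonal (eigval X) * P.transpose}

/-- `√Λ P_Iᵀ`, with `Λ = Diag(λ₁(X), …, λ_m(X))` and `P_I` the first `m` columns of `P`. -/
noncomputable def factorOf (hm : m ≤ p) (X : Sym p) (P : Matrix (Fin p) (Fin p) ℝ) :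
    RMat m p :=
  ofMat (Matrix.diagonal (fun i : Fin m => Real.sqrt (eigval X (Fin.castLE hm i)))
    * (P.submatrix id (Fin.castLE hm)).transpose)

/-- `∇f(VᵀV) + ρ (I + W) + Diag y`. -/
noncomputable def dualMat (f : Sym p → ℝ) (ρ : ℝ) (V : RMat m p)
    (W : Sym p) (y : Fin p → ℝ) : Sym p :=
  ∇ f (gram V) + ρ • (idMat p + W) + diagMat y

end Problem

end DCSDP

namespace DCSDP

/-! ### Rayleigh quotients and the spectral norm of symmetric matrices -/

section Symmetric

variable {m p : ℕ}

/-! On `Omega` the trace is `p`, so the penalty term is `p - ‖X‖`. Everything about feasibility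
follows from an error bound (`exists_sign_norm_sub_le`): each `Z ∈ Ω` lies within `(1 + 2p)(p -
‖Z‖)` of some `x xᵀ` with `x` a sign vector. Thus the feasible set consists of these finitely many
isolated rank-one matrices, all its normal cones are the whole space, and any `ρ > (1 + 2p)α` makes
the penalty dominate the possible decrease of `f` near a feasible point. For the second formula in
(i), `-∇f(x xᵀ)` splits as `Diag y + H` with `H x = 0`: `Diag y` is normal to `Ω`, and `H` is normal
to the matrices of rank at most one because `⟨H, Z⟩` is of second order there.

The nonsmooth part rests on one observation. If `u` is a unit vector with `⟨u uᵀ, X⟩ = ‖X‖`, then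
`-⟨u uᵀ, ·⟩` is a linear majorant of `ψ` touching it at `X`. A regular subgradient of `ψ` must
therefore equal `-u uᵀ`. Conversely, moving to `X + t u uᵀ` makes the top eigenvalue simple, where
`-u uᵀ` is a regular subgradient (`specNorm_add_smul_outer`), and `t → 0` gives a limiting one. The
same majorant splits regular subgradients of `Φ_ρ`, and compactness of the sphere passes the
splitting to the limit, giving (ii).

For (iv), the map `V ↦ VᵀV` pulls `-u uᵀ` back to `-2 V u uᵀ`, and perturbing `V` along `V u uᵀ`
moves `VᵀV` along `u uᵀ`, so subgradients transfer in both directions. Normals to the convex set `Ω`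
pull back to normals to the unit-column matrices; conversely those normals have the form `V Diag z`.
A positive semidefinite `S` with `V S = 0` satisfies `⟨S, Z - VᵀV⟩ ≥ 0` on `Ω`, which turns it into
a normal vector. -/

theorem rmat_inner_eq_sum (A B : RMat m p) :
    inner ℝ A B = ∑ i, ∑ j, mat A i j * mat B i j := by
  simp only [PiLp.inner_apply, Fintype.sum_prod_type, mat_apply]
  simp [mul_comm]

theorem rmat_norm_sq (A : RMat m p) : ‖A‖ ^ 2 = ∑ i, ∑ j, mat A i j ^ 2 := by
  rw [← real_inner_self_eq_norm_sq, rmat_inner_eq_sum]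
  simp only [sq]

theorem sym_inner_eq_sum (X Y : Sym p) :
    inner ℝ X Y = ∑ i, ∑ j, smat X i j * smat Y i j := by
  rw [Submodule.coe_inner, rmat_inner_eq_sum]

theorem sym_norm_sq (X : Sym p) : ‖X‖ ^ 2 = ∑ i, ∑ j, smat X i j ^ 2 := by
  exact rmat_norm_sq (X : RMat p p)

theorem sym_inner_smul_right (c : ℝ) (X Y : Sym p) :
    inner ℝ X (c • Y) = c * inner ℝ X Y := real_inner_smul_right X Y c

theorem sym_inner_smul_left (c : ℝ) (X Y : Sym p) :
    inner ℝ (c • X) Y = c * inner ℝ X Y := real_inner_smul_left X Y c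

theorem sym_ext {X Y : Sym p} (h : ∀ i j, smat X i j = smat Y i j) : X = Y := by
  apply Subtype.ext
  ext ⟨i, j⟩
  exact h i j

theorem smat_symm (X : Sym p) (i j : Fin p) : smat X i j = smat X j i :=
  Matrix.IsSymm.apply X.2 j i

theorem abs_smat_le_norm (X : Sym p) (i j : Fin p) : |smat X i j| ≤ ‖X‖ := by
  apply abs_le_of_sq_le_sq _ (norm_nonneg _)
  rw [sym_norm_sq]
  calc smat X i j ^ 2 ≤ ∑ j, smat X i j ^ 2 :=
        Finset.single_le_sum (f := fun j => smat X i j ^ 2) (fun _ _ => sq_nonneg _)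
          (Finset.mem_univ j)
    _ ≤ _ := Finset.single_le_sum (f := fun i => ∑ j, smat X i j ^ 2)
          (fun _ _ => Finset.sum_nonneg fun _ _ => sq_nonneg _) (Finset.mem_univ i)

theorem smat_add (X Y : Sym p) : smat (X + Y) = smat X + smat Y := rfl

theorem smat_sub (X Y : Sym p) : smat (X - Y) = smat X - smat Y := rfl

theorem smat_smul (c : ℝ) (X : Sym p) : smat (c • X) = c • smat X := rfl

theorem smat_idMat : smat (idMat p) = 1 := rfl

theorem smat_diagMat (y : Fin p → ℝ) : smat (diagMat y) = Matrix.diagonal y := rfl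

theorem smat_gram (V : RMat m p) : smat (gram V) = (mat V).transpose * mat V := rfl

theorem inner_idMat (X : Sym p) : inner ℝ (idMat p) X = ∑ i, smat X i i := by
  rw [sym_inner_eq_sum]
  simp only [smat_idMat, Matrix.one_apply, ite_mul, one_mul, zero_mul, Finset.sum_ite_eq,
    Finset.mem_univ, if_true]

theorem inner_diagMat (y : Fin p → ℝ) (X : Sym p) :
    inner ℝ (diagMat y) X = ∑ i, y i * smat X i i := by
  rw [sym_inner_eq_sum]
  simp only [smat_diagMat, Matrix.diagonal_apply, ite_mul, zero_mul, Finset.sum_ite_eq,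
    Finset.mem_univ, if_true]

/-- The self-adjoint operator of a symmetric matrix. -/
noncomputable def opOf (X : Sym p) :
    EuclideanSpace ℝ (Fin p) →L[ℝ] EuclideanSpace ℝ (Fin p) :=
  Matrix.toEuclideanCLM (𝕜 := ℝ) (smat X)

theorem specNorm_eq (X : Sym p) : specNorm X = ‖opOf X‖ := rfl

theorem opOf_apply (X : Sym p) (u : EuclideanSpace ℝ (Fin p)) (i : Fin p) :
    opOf X u i = ∑ j, smat X i j * u j := rfl

theorem opOf_add (X Y : Sym p) : opOf (X + Y) = opOf X + opOf Y := by
  rw [opOf, smat_add, map_add]; rfl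

theorem opOf_sub (X Y : Sym p) : opOf (X - Y) = opOf X - opOf Y := by
  rw [opOf, smat_sub, map_sub]; rfl

theorem opOf_smul (c : ℝ) (X : Sym p) : opOf (c • X) = c • opOf X := by
  rw [opOf, smat_smul, map_smul]; rfl

theorem opOf_symm (X : Sym p) (u v : EuclideanSpace ℝ (Fin p)) :
    inner ℝ (opOf X u) v = inner ℝ u (opOf X v) := by
  simp only [PiLp.inner_apply, opOf_apply, RCLike.inner_apply, conj_trivial, Finset.mul_sum,
    Finset.sum_mul]
  rw [Finset.sum_comm]
  refine Finset.sum_congr rfl fun i _ => Finset.sum_congr rfl fun j _ => ?_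
  rw [smat_symm X i j]; ring

/-- The matrix `u uᵀ`. -/
def outer (u : EuclideanSpace ℝ (Fin p)) : Sym p :=
  mkSym (Matrix.vecMulVec u u) (by
    ext i j
    simp [Matrix.vecMulVec_apply, mul_comm])

theorem smat_outer (u : EuclideanSpace ℝ (Fin p)) (i j : Fin p) :
    smat (outer u) i j = u i * u j := rfl

theorem inner_outer (u : EuclideanSpace ℝ (Fin p)) (X : Sym p) :
    inner ℝ (outer u) X = inner ℝ u (opOf X u) := by
  rw [sym_inner_eq_sum]
  simp only [PiLp.inner_apply, opOf_apply, RCLike.inner_apply, conj_trivial, smat_outer,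
    Finset.sum_mul]
  refine Finset.sum_congr rfl fun i _ => Finset.sum_congr rfl fun j _ => ?_
  ring

theorem opOf_outer (u v : EuclideanSpace ℝ (Fin p)) : opOf (outer u) v = inner ℝ u v • u := by
  ext i
  simp only [opOf_apply, smat_outer, PiLp.smul_apply, PiLp.inner_apply, RCLike.inner_apply,
    conj_trivial, smul_eq_mul, Finset.sum_mul]
  exact Finset.sum_congr rfl fun j _ => by ring

theorem norm_outer (u : EuclideanSpace ℝ (Fin p)) : ‖outer u‖ = ‖u‖ ^ 2 := by
  have h : ‖outer u‖ ^ 2 = (‖u‖ ^ 2) ^ 2 := by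
    rw [← real_inner_self_eq_norm_sq, inner_outer, opOf_outer, inner_smul_right,
      real_inner_self_eq_norm_sq]
    ring
  exact (pow_left_inj₀ (norm_nonneg _) (by positivity) two_ne_zero).1 h

theorem continuous_outer : Continuous (outer : EuclideanSpace ℝ (Fin p) → Sym p) := by
  apply Continuous.subtype_mk
  apply (PiLp.continuous_toLp 2 _).comp
  fun_prop

theorem norm_opOf_le (X : Sym p) : ‖opOf X‖ ≤ ‖X‖ := by
  refine ContinuousLinearMap.opNorm_le_bound _ (norm_nonneg _) fun u => ?_
  apply abs_le_of_sq_le_sq' _ (by positivity) |>.2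
  rw [mul_pow, sym_norm_sq, EuclideanSpace.norm_sq_eq, EuclideanSpace.norm_sq_eq, Finset.sum_mul]
  refine Finset.sum_le_sum fun i _ => ?_
  simp only [opOf_apply, Real.norm_eq_abs, sq_abs]
  exact Finset.sum_mul_sq_le_sq_mul_sq _ _ _

theorem specNorm_nonneg (X : Sym p) : 0 ≤ specNorm X := norm_nonneg _

theorem specNorm_sub_le (X Y : Sym p) : specNorm X - specNorm Y ≤ ‖X - Y‖ := by
  rw [specNorm_eq, specNorm_eq]
  refine (norm_sub_norm_le _ _).trans ?_
  rw [← opOf_sub]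
  exact norm_opOf_le _

theorem continuous_specNorm : Continuous (specNorm : Sym p → ℝ) := by
  have : LipschitzWith 1 (specNorm : Sym p → ℝ) :=
    LipschitzWith.of_le_add fun X Y => by
      have := specNorm_sub_le X Y
      rw [dist_eq_norm]; linarith
  exact this.continuous

theorem abs_inner_outer_le (u : EuclideanSpace ℝ (Fin p)) (X : Sym p) :
    |inner ℝ (outer u) X| ≤ specNorm X * ‖u‖ ^ 2 := by
  rw [inner_outer, specNorm_eq]
  calc _ ≤ ‖u‖ * ‖opOf X u‖ := abs_real_inner_le_norm _ _
    _ ≤ ‖u‖ * (‖opOf X‖ * ‖u‖) := by gcongr; exact (opOf X).le_opNorm u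
    _ = _ := by ring

/-- The norm of a self-adjoint operator is the supremum of its absolute Rayleigh quotients. -/
theorem specNorm_le_of_forall {X : Sym p} {M : ℝ} (hM : 0 ≤ M)
    (h : ∀ u, |inner ℝ (outer u) X| ≤ M * ‖u‖ ^ 2) : specNorm X ≤ M := by
  rw [specNorm_eq, ContinuousLinearMap.norm_eq_iSup_rayleighQuotient (opOf X)
    (fun u v => opOf_symm X u v)]
  refine Real.iSup_le (fun u => ?_) hM
  have hu := h u
  rw [inner_outer] at hu
  rw [abs_div, abs_of_nonneg (sq_nonneg ‖u‖)]
  refine div_le_of_le_mul₀ (sq_nonneg _) hM ?_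
  rwa [ContinuousLinearMap.reApplyInnerSelf_apply, RCLike.re_to_real, opOf_symm]

theorem exists_specNorm_eq (hp : 0 < p) (X : Sym p) :
    ∃ u : EuclideanSpace ℝ (Fin p), ‖u‖ = 1 ∧ |inner ℝ (outer u) X| = specNorm X := by
  have : Nonempty (Fin p) := ⟨⟨0, hp⟩⟩
  have hne : (Metric.sphere (0 : EuclideanSpace ℝ (Fin p)) 1).Nonempty :=
    NormedSpace.sphere_nonempty.2 zero_le_one
  obtain ⟨u, hu, hmax⟩ := (isCompact_sphere (0 : EuclideanSpace ℝ (Fin p)) 1).exists_isMaxOn hne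
    (f := fun u => |inner ℝ (outer u) X|)
    ((continuous_outer.inner continuous_const).abs.continuousOn)
  have hu1 : ‖u‖ = 1 := by simpa using hu
  refine ⟨u, hu1, le_antisymm ?_ ?_⟩
  · simpa [hu1] using abs_inner_outer_le u X
  refine specNorm_le_of_forall (abs_nonneg _) fun v => ?_
  rcases eq_or_ne v 0 with rfl | hv
  · rw [inner_outer]; simp
  have hv0 : ‖v‖ ≠ 0 := norm_ne_zero_iff.2 hv
  have hs := hmax (a := ‖v‖⁻¹ • v) (by simp [norm_smul, hv0])
  have e : inner ℝ (outer (‖v‖⁻¹ • v)) X = (‖v‖ ^ 2)⁻¹ * inner ℝ (outer v) X := by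
    rw [inner_outer, inner_outer, map_smul, inner_smul_left, inner_smul_right]
    simp; ring
  simp only [Set.mem_ofPred_eq, e, abs_mul, abs_inv, abs_pow, abs_norm] at hs
  rw [inv_mul_le_iff₀ (by positivity)] at hs
  linarith

/-- Expanding the square, `‖X u - ‖X‖ u‖² = ‖X u‖² - ‖X‖² ≤ 0`. -/
theorem opOf_eq_of_inner_eq {X : Sym p} {u : EuclideanSpace ℝ (Fin p)} (hu : ‖u‖ = 1)
    (h : inner ℝ (outer u) X = specNorm X) : opOf X u = specNorm X • u := by
  rw [← sub_eq_zero, ← norm_eq_zero, ← sq_eq_zero_iff]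
  refine le_antisymm ?_ (sq_nonneg _)
  rw [norm_sub_sq_real, inner_smul_right, real_inner_comm, ← inner_outer, h, norm_smul, hu,
    Real.norm_eq_abs, mul_one, sq_abs]
  have h1 : ‖opOf X u‖ ≤ specNorm X := by
    simpa [hu, specNorm_eq] using (opOf X).le_opNorm u
  nlinarith [norm_nonneg (opOf X u)]

theorem posSemidef_iff_inner_outer (X : Sym p) :
    (smat X).PosSemidef ↔ ∀ u, 0 ≤ inner ℝ (outer u) X := by
  rw [Matrix.posSemidef_iff_dotProduct_mulVec]
  constructor
  · rintro ⟨-, h⟩ u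
    rw [inner_outer, opOf, Matrix.inner_toEuclideanCLM]
    simpa using h u.ofLp
  · intro h
    refine ⟨smat_isHermitian X, fun v => ?_⟩
    have := h (WithLp.toLp 2 v)
    rw [inner_outer, opOf, Matrix.inner_toEuclideanCLM] at this
    simpa using this

theorem exists_inner_outer_eq_specNorm (hp : 0 < p) {X : Sym p} (hX : (smat X).PosSemidef) :
    ∃ u : EuclideanSpace ℝ (Fin p), ‖u‖ = 1 ∧ inner ℝ (outer u) X = specNorm X := by
  obtain ⟨u, hu, h⟩ := exists_specNorm_eq hp X
  rw [abs_of_nonneg ((posSemidef_iff_inner_outer X).1 hX u)] at h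
  exact ⟨u, hu, h⟩

/-- Orthogonal decomposition along a unit vector. -/
theorem exists_decomp {E : Type*} [NormedAddCommGroup E] [InnerProductSpace ℝ E] {u : E}
    (hu : ‖u‖ = 1) (v : E) :
    ∃ (a : ℝ) (w : E), v = a • u + w ∧ inner ℝ u w = 0 ∧ ‖v‖ ^ 2 = a ^ 2 + ‖w‖ ^ 2 := by
  have h : inner ℝ u (v - inner ℝ u v • u) = 0 := by
    rw [inner_sub_right, inner_smul_right, real_inner_self_eq_norm_sq, hu]; ring
  refine ⟨inner ℝ u v, v - inner ℝ u v • u, by simp, h, ?_⟩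
  have e : v = inner ℝ u v • u + (v - inner ℝ u v • u) := by simp
  conv_lhs => rw [e]
  rw [norm_add_sq_real, inner_smul_left, h, norm_smul, hu]
  simp

theorem inner_outer_decomp (X : Sym p) (u w : EuclideanSpace ℝ (Fin p)) (a : ℝ) :
    inner ℝ (outer (a • u + w)) X =
      a ^ 2 * inner ℝ (outer u) X + 2 * a * inner ℝ w (opOf X u) + inner ℝ (outer w) X := by
  simp only [inner_outer, map_add, map_smul, inner_add_left, inner_add_right, inner_smul_left,
    inner_smul_right, conj_trivial]
  rw [← opOf_symm X u w, real_inner_comm w (opOf X u)]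
  ring

/-- Adding `t u uᵀ` opens a gap of at least `t` between the eigenvalue at `u` and the form on `u⊥`.
A perturbation `D` couples the two only through the cross term `⟨w, D u⟩`, which the gap absorbs at
a cost quadratic in `‖D‖`. -/
theorem specNorm_add_smul_outer {X : Sym p} {u : EuclideanSpace ℝ (Fin p)} (hu : ‖u‖ = 1)
    (h : inner ℝ (outer u) X = specNorm X) {t : ℝ} (ht : 0 < t) :
    ∀ᶠ Y in 𝓝 (X + t • outer u),
      specNorm Y ≤ inner ℝ (outer u) Y + 2 / t * ‖Y - (X + t • outer u)‖ ^ 2 := by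
  -- With `‖D‖ ≤ t/4`, half of the gap survives (`hgap` below) after `D` has acted on both `u` and
  -- `u⊥`.
  have hball : Metric.ball (X + t • outer u) (t / 4) ∈ 𝓝 (X + t • outer u) :=
    Metric.ball_mem_nhds _ (by positivity)
  filter_upwards [hball] with Y hY
  rw [Metric.mem_ball, dist_eq_norm] at hY
  obtain ⟨D, rfl⟩ : ∃ D, Y = X + t • outer u + D := ⟨Y - (X + t • outer u), by abel⟩
  rw [add_sub_cancel_left] at hY ⊢
  have hn := specNorm_nonneg X
  have hop := opOf_eq_of_inner_eq hu h
  have hD : ∀ v w : EuclideanSpace ℝ (Fin p), |inner ℝ v (opOf D w)| ≤ ‖D‖ * (‖v‖ * ‖w‖) := by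
    intro v w
    calc _ ≤ ‖v‖ * ‖opOf D w‖ := abs_real_inner_le_norm _ _
      _ ≤ ‖v‖ * (‖D‖ * ‖w‖) := by
        gcongr
        exact ((opOf D).le_opNorm w).trans (by gcongr; exact norm_opOf_le D)
      _ = _ := by ring
  have huu : inner ℝ (outer u) (X + t • outer u + D)
      = specNorm X + t + inner ℝ u (opOf D u) := by
    rw [inner_add_right, inner_add_right, sym_inner_smul_right, real_inner_self_eq_norm_sq,
      norm_outer, hu, h, inner_outer]
    ring
  have hDu := hD u u
  rw [hu] at hDu
  have hDu' := abs_le.1 hDu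
  have hK : 0 ≤ 2 / t * ‖D‖ ^ 2 := by positivity
  have hd := norm_nonneg D
  refine specNorm_le_of_forall (by rw [huu]; linarith) fun v => ?_
  obtain ⟨a, w, rfl, huw, hnv⟩ := exists_decomp hu v
  rw [hnv, inner_outer_decomp]
  have hwY : inner ℝ w (opOf (X + t • outer u + D) u) = inner ℝ w (opOf D u) := by
    rw [opOf_add, opOf_add, opOf_smul, add_apply,
      add_apply, smul_apply, opOf_outer, hop]
    simp only [inner_add_right, inner_smul_right, real_inner_comm u w, huw]
    ring
  have hww : inner ℝ (outer w) (X + t • outer u + D)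
      = inner ℝ (outer w) X + inner ℝ w (opOf D w) := by
    rw [inner_add_right, inner_add_right, sym_inner_smul_right, inner_outer w (outer u), opOf_outer,
      huw, ← inner_outer]
    simp
  rw [hwY, hww]
  set A := inner ℝ (outer u) (X + t • outer u + D)
  have h1 := hD w u
  rw [hu] at h1
  have h2 := hD w w
  have h3 := abs_inner_outer_le w X
  have hA : 0 ≤ A := by rw [huu]; linarith
  have hgap : specNorm X + ‖D‖ + t / 2 ≤ A := by rw [huu]; linarith
  have h4 : |2 * a * inner ℝ w (opOf D u)| ≤ 2 * |a| * (‖D‖ * ‖w‖) := by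
    rw [abs_mul, abs_mul, abs_two]
    gcongr
    linarith
  -- Weighted AM-GM: the weight is chosen so that the `‖w‖²` part uses exactly the surviving half
  -- gap `t/2`.
  have h5 : 2 * |a| * (‖D‖ * ‖w‖) ≤ t / 2 * ‖w‖ ^ 2 + 2 / t * ‖D‖ ^ 2 * a ^ 2 := by
    have e : t / 2 * ‖w‖ ^ 2 + 2 / t * ‖D‖ ^ 2 * |a| ^ 2 - 2 * |a| * (‖D‖ * ‖w‖)
        = 2 / t * (t / 2 * ‖w‖ - ‖D‖ * |a|) ^ 2 := by
      field_simp
      ring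
    have : 0 ≤ 2 / t * (t / 2 * ‖w‖ - ‖D‖ * |a|) ^ 2 := by positivity
    rw [sq_abs] at e
    linarith
  calc |a ^ 2 * A + 2 * a * inner ℝ w (opOf D u)
          + (inner ℝ (outer w) X + inner ℝ w (opOf D w))|
      ≤ |a ^ 2 * A| + |2 * a * inner ℝ w (opOf D u)|
          + (|inner ℝ (outer w) X| + |inner ℝ w (opOf D w)|) :=
        (abs_add_le _ _).trans (add_le_add (abs_add_le _ _) (abs_add_le _ _))
    _ ≤ a ^ 2 * A + (t / 2 * ‖w‖ ^ 2 + 2 / t * ‖D‖ ^ 2 * a ^ 2)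
          + (specNorm X * ‖w‖ ^ 2 + ‖D‖ * (‖w‖ * ‖w‖)) := by
        gcongr
        · rw [abs_of_nonneg (by positivity)]
        · exact h4.trans h5
    _ ≤ _ := by nlinarith [mul_le_mul_of_nonneg_right hgap (sq_nonneg ‖w‖),
                  mul_nonneg hK (sq_nonneg ‖w‖)]

end Symmetric

end DCSDP

namespace DCSDP

/-! ### The error bound, sign matrices and exact penalization -/

section Feasible

variable {m p : ℕ}

theorem mul_eq_mul_of_rank_le_one {n n' : ℕ} {A : Matrix (Fin n) (Fin n') ℝ} (hA : A.rank ≤ 1)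
    (i k : Fin n) (j l : Fin n') : A i j * A k l = A i l * A k j := by
  rw [Matrix.rank, finrank_le_one_iff] at hA
  obtain ⟨v, hv⟩ := hA
  have hcol : ∀ j, ∃ c : ℝ, ∀ i, A i j = c * (v : Fin n → ℝ) i := by
    intro j
    obtain ⟨c, hc⟩ := hv ⟨A.mulVecLin (Pi.single j 1), LinearMap.mem_range_self _ _⟩
    refine ⟨c, fun i => ?_⟩
    have := congrFun (congrArg Subtype.val hc) i
    simpa using this.symm
  obtain ⟨c, hc⟩ := hcol j
  obtain ⟨d, hd⟩ := hcol l
  rw [hc, hc, hd, hd]; ring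

theorem inner_single_opOf_single (B : Sym p) (i j : Fin p) :
    inner ℝ (EuclideanSpace.single i (1 : ℝ)) (opOf B (EuclideanSpace.single j 1))
      = smat B i j := by
  rw [EuclideanSpace.inner_single_left, opOf_apply]
  simp

/-- The form at `t eⱼ + eᵢ` is a nonnegative quadratic in `t`, so its discriminant is nonpositive.
-/
theorem sq_smat_le_of_posSemidef {B : Sym p} (hB : (smat B).PosSemidef) (i j : Fin p) :
    smat B i j ^ 2 ≤ smat B i i * smat B j j := by
  have h : discrim (smat B j j) (2 * smat B i j) (smat B i i) ≤ 0 := by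
    apply discrim_le_zero
    intro t
    have := (posSemidef_iff_inner_outer B).1 hB
      (t • EuclideanSpace.single j 1 + EuclideanSpace.single i 1)
    rw [inner_outer_decomp, inner_outer, inner_outer, inner_single_opOf_single,
      inner_single_opOf_single, inner_single_opOf_single] at this
    linarith
  rw [discrim] at h
  nlinarith

theorem norm_le_sum_abs (X : Sym p) : ‖X‖ ≤ ∑ i, ∑ j, |smat X i j| := by
  have h : ‖X‖ ^ 2 ≤ (∑ i, ∑ j, |smat X i j|) ^ 2 := by
    rw [sym_norm_sq]
    calc ∑ i, ∑ j, smat X i j ^ 2 ≤ ∑ i, (∑ j, |smat X i j|) ^ 2 := by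
          refine Finset.sum_le_sum fun i _ => ?_
          have := Finset.sum_sq_le_sq_sum_of_nonneg (s := Finset.univ)
            (f := fun j => |smat X i j|) (fun _ _ => abs_nonneg _)
          simpa only [sq_abs] using this
      _ ≤ _ := Finset.sum_sq_le_sq_sum_of_nonneg
          (fun _ _ => Finset.sum_nonneg fun _ _ => abs_nonneg _)
  exact (pow_le_pow_iff_left₀ (norm_nonneg _)
    (Finset.sum_nonneg fun _ _ => Finset.sum_nonneg fun _ _ => abs_nonneg _) two_ne_zero).1 h

theorem norm_le_trace_of_posSemidef {B : Sym p} (hB : (smat B).PosSemidef) :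
    ‖B‖ ≤ ∑ i, smat B i i := by
  have hd : ∀ i, 0 ≤ smat B i i := fun i => hB.diag_nonneg
  have h : ‖B‖ ^ 2 ≤ (∑ i, smat B i i) ^ 2 := by
    rw [sym_norm_sq, sq, Finset.sum_mul_sum]
    exact Finset.sum_le_sum fun i _ => Finset.sum_le_sum fun j _ => sq_smat_le_of_posSemidef hB i j
  exact (pow_le_pow_iff_left₀ (norm_nonneg _) (Finset.sum_nonneg fun i _ => hd i)
    two_ne_zero).1 h

/-- Since `u` is an eigenvector for `‖Z‖`, the difference kills `u` and agrees with `Z` on `u⊥`. -/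
theorem posSemidef_sub_specNorm_smul_outer {Z : Sym p} (hZ : (smat Z).PosSemidef)
    {u : EuclideanSpace ℝ (Fin p)} (hu : ‖u‖ = 1) (h : inner ℝ (outer u) Z = specNorm Z) :
    (smat (Z - specNorm Z • outer u)).PosSemidef := by
  rw [posSemidef_iff_inner_outer]
  intro v
  obtain ⟨a, w, rfl, huw, -⟩ := exists_decomp hu v
  have hop := opOf_eq_of_inner_eq hu h
  have hop2 : opOf (Z - specNorm Z • outer u) u = 0 := by
    rw [opOf_sub, opOf_smul, sub_apply, smul_apply, opOf_outer, hop, real_inner_self_eq_norm_sq,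
      hu]
    simp
  rw [inner_outer_decomp, hop2, inner_outer u, hop2, inner_sub_right, sym_inner_smul_right,
    inner_outer w (outer u), opOf_outer, huw]
  simpa using (posSemidef_iff_inner_outer Z).1 hZ w

theorem norm_sq_of_isSign {x : EuclideanSpace ℝ (Fin p)} (hx : ∀ i, x i = 1 ∨ x i = -1) :
    ‖x‖ ^ 2 = p := by
  rw [EuclideanSpace.norm_sq_eq]
  have : ∀ i, ‖x i‖ ^ 2 = 1 := fun i => by rcases hx i with h | h <;> simp [h]
  rw [Finset.sum_congr rfl fun i _ => this i]; simp

/-- The error bound for the feasible set of the DC-constrained problem. -/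
theorem exists_sign_norm_sub_le (hp : 0 < p) {Z : Sym p} (hZ : Z ∈ Omega p) :
    ∃ x : EuclideanSpace ℝ (Fin p), (∀ i, x i = 1 ∨ x i = -1) ∧
      ‖Z - outer x‖ ≤ (1 + 2 * (p : ℝ)) * (p - specNorm Z) := by
  obtain ⟨u, hu, h⟩ := exists_inner_outer_eq_specNorm hp hZ.1
  have hB := posSemidef_sub_specNorm_smul_outer hZ.1 hu h
  set n := specNorm Z
  have hn : 0 ≤ n := specNorm_nonneg Z
  have hd : ∀ i, smat (Z - n • outer u) i i = 1 - n * u i ^ 2 := fun i => by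
    rw [smat_sub, smat_smul, Matrix.sub_apply, Matrix.smul_apply, smat_outer, hZ.2 i, smul_eq_mul]
    ring
  have hd0 : ∀ i, 0 ≤ 1 - n * u i ^ 2 := fun i => hd i ▸ hB.diag_nonneg
  have hu2 : ∑ i, u i ^ 2 = 1 := by
    have := EuclideanSpace.norm_sq_eq u
    simp only [Real.norm_eq_abs, sq_abs, hu] at this
    linarith
  have hsum : ∑ i, (1 - n * u i ^ 2) = p - n := by
    rw [Finset.sum_sub_distrib, ← Finset.mul_sum, hu2]; simp
  -- The remainder is positive semidefinite, so its Frobenius norm is at most its trace `p - n`.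
  have h1 : ‖Z - n • outer u‖ ≤ p - n := by
    refine (norm_le_trace_of_posSemidef hB).trans_eq ?_
    rw [← hsum]
    exact Finset.sum_congr rfl fun i _ => hd i
  -- Here `n u uᵀ = b bᵀ`. Rounding `b` to its signs `x` costs `1 - |bᵢ| ≤ 1 - bᵢ²` per entry, and
  -- these bounds sum to `p - n`.
  set b : Fin p → ℝ := fun i => √n * u i
  have hb2 : ∀ i, b i ^ 2 = n * u i ^ 2 := fun i => by
    simp only [b, mul_pow, Real.sq_sqrt hn]
  have hb1 : ∀ i, |b i| ≤ 1 := fun i => by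
    rw [← sq_le_one_iff_abs_le_one, hb2]; linarith [hd0 i]
  set x : EuclideanSpace ℝ (Fin p) := WithLp.toLp 2 fun i => if 0 ≤ b i then 1 else -1
  have hx : ∀ i, x i = 1 ∨ x i = -1 := fun i => by
    simp only [x]
    split_ifs <;> simp
  have hbx : ∀ i, |b i - x i| ≤ 1 - n * u i ^ 2 := fun i => by
    rw [← hb2]
    have := abs_le.1 (hb1 i)
    simp only [x]
    split_ifs with h0
    · rw [abs_le]; constructor <;> nlinarith
    · rw [abs_le]; constructor <;> nlinarith
  have hentry : ∀ i j, |smat (n • outer u - outer x) i j|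
      ≤ (1 - n * u i ^ 2) + (1 - n * u j ^ 2) := fun i j => by
    have e : smat (n • outer u - outer x) i j = b i * (b j - x j) + (b i - x i) * x j := by
      rw [smat_sub, smat_smul, Matrix.sub_apply, Matrix.smul_apply, smat_outer, smat_outer,
        smul_eq_mul]
      have : √n * √n = n := Real.mul_self_sqrt hn
      simp only [b]
      linear_combination (-u i * u j) * this
    have hxj : |x j| = 1 := by rcases hx j with h | h <;> simp [h]
    calc _ ≤ |b i * (b j - x j)| + |(b i - x i) * x j| := e ▸ abs_add_le _ _
      _ = |b i| * |b j - x j| + |b i - x i| := by rw [abs_mul (b i), abs_mul (b i - x i), hxj, mul_one]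
      _ ≤ 1 * (1 - n * u j ^ 2) + (1 - n * u i ^ 2) := by
        gcongr
        · exact hb1 i
        · exact hbx j
        · exact hbx i
      _ = _ := by ring
  -- Each of the two terms of the entrywise bound, summed over all pairs `(i, j)`, gives `p (p -
  -- n)`.
  have h2 : ‖n • outer u - outer x‖ ≤ 2 * p * (p - n) := by
    refine (norm_le_sum_abs _).trans ?_
    refine (Finset.sum_le_sum fun i _ => Finset.sum_le_sum fun j _ => hentry i j).trans_eq ?_
    simp only [Finset.sum_add_distrib, Finset.sum_const, hsum, Finset.card_univ, Fintype.card_fin,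
      nsmul_eq_mul, ← Finset.mul_sum]
    ring
  refine ⟨x, hx, ?_⟩
  calc ‖Z - outer x‖ = ‖(Z - n • outer u) + (n • outer u - outer x)‖ := by rw [sub_add_sub_cancel]
    _ ≤ (p - n) + 2 * p * (p - n) := (norm_add_le _ _).trans (add_le_add h1 h2)
    _ = _ := by ring

theorem inner_idMat_of_mem_Omega {X : Sym p} (hX : X ∈ Omega p) : inner ℝ (idMat p) X = p := by
  rw [inner_idMat]; simp only [hX.2]; simp

theorem outer_mem_Omega {x : EuclideanSpace ℝ (Fin p)} (hx : ∀ i, x i = 1 ∨ x i = -1) :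
    outer x ∈ Omega p := by
  refine ⟨(posSemidef_iff_inner_outer _).2 fun u => ?_, fun i => ?_⟩
  · rw [inner_outer, opOf_outer, inner_smul_right, real_inner_comm x u]
    exact mul_self_nonneg _
  · rw [smat_outer]; rcases hx i with h | h <;> simp [h]

theorem specNorm_outer (hp : 0 < p) {x : EuclideanSpace ℝ (Fin p)}
    (hx : ∀ i, x i = 1 ∨ x i = -1) : specNorm (outer x) = p := by
  have hp' : (0 : ℝ) < p := by exact_mod_cast hp
  have hn := norm_sq_of_isSign hx
  refine le_antisymm ?_ ?_
  · rw [← hn, ← norm_outer, specNorm_eq]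
    exact norm_opOf_le _
  · have := abs_inner_outer_le x (outer x)
    rw [real_inner_self_eq_norm_sq, norm_outer, hn, abs_of_nonneg (by positivity)] at this
    nlinarith

theorem mem_feasible_iff (hp : 0 < p) {X : Sym p} : X ∈ feasible p ↔
    ∃ x : EuclideanSpace ℝ (Fin p), (∀ i, x i = 1 ∨ x i = -1) ∧ X = outer x := by
  constructor
  · rintro ⟨h1, h2, h3⟩
    have hX : X ∈ Omega p := ⟨h3, h2⟩
    obtain ⟨x, hx, h⟩ := exists_sign_norm_sub_le hp hX
    rw [inner_idMat_of_mem_Omega hX] at h1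
    rw [h1, mul_zero] at h
    exact ⟨x, hx, sub_eq_zero.1 (norm_le_zero_iff.1 h)⟩
  · rintro ⟨x, hx, rfl⟩
    have hX := outer_mem_Omega hx
    refine ⟨?_, hX.2, hX.1⟩
    rw [inner_idMat_of_mem_Omega hX, specNorm_outer hp hx, sub_self]

theorem mem_Omega_of_mem_feasible {X : Sym p} (hX : X ∈ feasible p) : X ∈ Omega p :=
  ⟨hX.2.2, hX.2.1⟩

theorem specNorm_of_mem_feasible {X : Sym p} (hX : X ∈ feasible p) : specNorm X = p := by
  have := hX.1
  rw [inner_idMat_of_mem_Omega (mem_Omega_of_mem_feasible hX)] at this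
  linarith

theorem mem_feasible_of_rank_le_one (hp : 0 < p) {X : Sym p} (hX : X ∈ Omega p)
    (hr : (smat X).rank ≤ 1) : X ∈ feasible p := by
  refine (mem_feasible_iff hp).2 ⟨WithLp.toLp 2 fun i => smat X i ⟨0, hp⟩, fun i => ?_, ?_⟩
  · have := mul_eq_mul_of_rank_le_one hr i ⟨0, hp⟩ i ⟨0, hp⟩
    rw [hX.2, hX.2, smat_symm X ⟨0, hp⟩ i] at this
    exact mul_self_eq_one_iff.1 (by linarith)
  · refine sym_ext fun i j => ?_
    rw [smat_outer]
    have := mul_eq_mul_of_rank_le_one hr i ⟨0, hp⟩ j ⟨0, hp⟩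
    rw [hX.2, smat_symm X ⟨0, hp⟩ j] at this
    linarith

theorem rank_of_mem_feasible (hp : 0 < p) {X : Sym p} (hX : X ∈ feasible p) :
    (smat X).rank = 1 := by
  obtain ⟨x, hx, rfl⟩ := (mem_feasible_iff hp).1 hX
  refine le_antisymm (Matrix.rank_vecMulVec_le _ _) (Nat.one_le_iff_ne_zero.2 fun h => ?_)
  rw [Matrix.rank, Submodule.finrank_eq_zero, LinearMap.range_eq_bot] at h
  have h1 := hX.2.1 ⟨0, hp⟩
  have h2 := congrFun (LinearMap.congr_fun h (Pi.single ⟨0, hp⟩ 1)) ⟨0, hp⟩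
  rw [Matrix.mulVecLin_apply, Matrix.mulVec_single_one, Matrix.col_apply, h1] at h2
  simp at h2

/-- All entries are `±1`, so distinct matrices of this kind differ by `2` in some entry. -/
theorem eq_of_mem_feasible_of_norm_lt_one (hp : 0 < p) {X Y : Sym p} (hX : X ∈ feasible p)
    (hY : Y ∈ feasible p) (h : ‖X - Y‖ < 1) : X = Y := by
  obtain ⟨x, hx, rfl⟩ := (mem_feasible_iff hp).1 hX
  obtain ⟨y, hy, rfl⟩ := (mem_feasible_iff hp).1 hY
  refine sym_ext fun i j => ?_
  have hij := (abs_smat_le_norm (outer x - outer y) i j).trans_lt h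
  rw [smat_sub, Matrix.sub_apply, smat_outer, smat_outer] at hij
  rw [smat_outer, smat_outer]
  rcases hx i with h1 | h1 <;> rcases hx j with h2 | h2 <;> rcases hy i with h3 | h3 <;>
    rcases hy j with h4 | h4 <;> rw [h1, h2, h3, h4] at hij ⊢ <;> norm_num at hij <;> norm_num

/-- Near a feasible point, that point is the nearest one in the error bound. -/
theorem eventually_norm_sub_le (hp : 0 < p) {X : Sym p} (hX : X ∈ feasible p) :
    ∀ᶠ Z in 𝓝 X, Z ∈ Omega p → ‖Z - X‖ ≤ (1 + 2 * (p : ℝ)) * (p - specNorm Z) := by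
  -- Two halves bring the sign matrix of the error bound within distance less than `1` of `X`, hence
  -- equal to it.
  have h1 : ∀ᶠ Z in 𝓝 X, (1 + 2 * (p : ℝ)) * (p - specNorm Z) < 1 / 2 := by
    have hc : Continuous fun Z : Sym p => (1 + 2 * (p : ℝ)) * (p - specNorm Z) :=
      continuous_const.mul (continuous_const.sub continuous_specNorm)
    refine hc.continuousAt.eventually_lt continuousAt_const ?_
    rw [specNorm_of_mem_feasible hX]; norm_num
  have h2 : ∀ᶠ Z in 𝓝 X, ‖Z - X‖ < 1 / 2 := by
    filter_upwards [Metric.ball_mem_nhds X (by norm_num : (0 : ℝ) < 1 / 2)] with Z hZ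
    rwa [Metric.mem_ball, dist_eq_norm] at hZ
  filter_upwards [h1, h2] with Z hZ1 hZ2 hZ
  obtain ⟨x, hx, h⟩ := exists_sign_norm_sub_le hp hZ
  have : X = outer x := by
    refine eq_of_mem_feasible_of_norm_lt_one hp hX ((mem_feasible_iff hp).2 ⟨x, hx, rfl⟩) ?_
    have := norm_sub_le_norm_sub_add_norm_sub X Z (outer x)
    rw [norm_sub_rev X Z] at this
    linarith
  rwa [this]

/-- By the error bound, `f X - f Z ≤ α ‖Z - X‖ ≤ (1 + 2p) α (p - ‖Z‖)`, which is less than `ρ (p -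
‖Z‖)`. The quantifier over `ρ` sits inside the neighborhood, as part (iii) needs one neighborhood
for all `ρ`. -/
theorem eventually_penObj_lt (hp : 0 < p) {f : Sym p → ℝ} {α : ℝ≥0}
    (hα : LipschitzOnWith α f (Omega p)) {X : Sym p} (hX : X ∈ feasible p) :
    ∀ᶠ Z in 𝓝 X, ∀ ρ : ℝ, (1 + 2 * (p : ℝ)) * α < ρ → Z ∈ Omega p → Z ≠ X →
      penObj f ρ X < penObj f ρ Z := by
  filter_upwards [eventually_norm_sub_le hp hX] with Z h ρ hρ hZ hne
  have hb := h hZ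
  have hXO := mem_Omega_of_mem_feasible hX
  have hpos : 0 < p - specNorm Z := by
    have : 0 < ‖Z - X‖ := norm_pos_iff.2 (sub_ne_zero.2 hne)
    exact pos_of_mul_pos_right (this.trans_le hb) (by positivity)
  have hL := hα.dist_le_mul X hXO Z hZ
  rw [dist_comm X Z, dist_eq_norm Z X, Real.dist_eq] at hL
  have hL' := (abs_le.1 hL).2
  rw [penObj, penObj, inner_idMat_of_mem_Omega hXO, inner_idMat_of_mem_Omega hZ,
    specNorm_of_mem_feasible hX]
  have h1 : (α : ℝ) * ‖Z - X‖ ≤ α * ((1 + 2 * (p : ℝ)) * (p - specNorm Z)) := by gcongr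
  have h2 := mul_lt_mul_of_pos_right hρ hpos
  linarith

theorem inner_gram (V : RMat m p) (u : EuclideanSpace ℝ (Fin p)) :
    inner ℝ (outer u) (gram V) = ‖Matrix.toEuclideanLin (mat V) u‖ ^ 2 := by
  rw [inner_outer, opOf, Matrix.inner_toEuclideanCLM, smat_gram, ← Matrix.mulVec_mulVec,
    Matrix.dotProduct_mulVec, Matrix.vecMul_transpose, EuclideanSpace.norm_sq_eq]
  simp only [dotProduct, Matrix.toLpLin_apply, Real.norm_eq_abs, sq_abs]
  exact Finset.sum_congr rfl fun i _ => (sq _).symm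

theorem gram_posSemidef (V : RMat m p) : (smat (gram V)).PosSemidef :=
  (posSemidef_iff_inner_outer _).2 fun u => by rw [inner_gram]; positivity

theorem gram_mem_Omega_iff (V : RMat m p) : gram V ∈ Omega p ↔ V ∈ unitCols m p := by
  have key : ∀ j, smat (gram V) j j = ‖WithLp.toLp 2 (fun i => V (i, j))‖ ^ 2 := fun j => by
    rw [EuclideanSpace.norm_sq_eq, smat_gram, Matrix.mul_apply]
    simp [sq]
  constructor
  · intro h j
    have := h.2 j
    rw [key] at this
    exact (pow_eq_one_iff_of_nonneg (norm_nonneg _) two_ne_zero).1 this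
  · intro h
    refine ⟨gram_posSemidef V, fun j => ?_⟩
    rw [key, h j, one_pow]

end Feasible

end DCSDP

namespace DCSDP

/-! ### Regular and limiting subgradients, normal cones -/

section Subdifferential

open Filter

variable {E E' : Type*} [NormedAddCommGroup E] [InnerProductSpace ℝ E]
  [NormedAddCommGroup E'] [InnerProductSpace ℝ E']

theorem regSubdiff_subset_limSubdiff (h : E → EReal) (x : E) :
    regSubdiff h x ⊆ limSubdiff h x := fun v hv =>
  ⟨hv.1, hv.2.1, fun _ => x, fun _ => v, tendsto_const_nhds, tendsto_const_nhds, fun _ => hv,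
    tendsto_const_nhds⟩

/-- A regular subgradient is dominated by the directional derivatives of upper bounds along
differentiable curves. -/
theorem inner_le_of_mem_regSubdiff {h : E → EReal} {x v d : E} (hv : v ∈ regSubdiff h x)
    {γ : ℝ → E} (hγ : HasDerivAt γ d 0) (hγ0 : γ 0 = x) {φ : ℝ → ℝ} {c : ℝ}
    (hφ : HasDerivAt φ c 0) (hφ0 : h x = φ 0) (hle : ∀ᶠ t in 𝓝[>] (0 : ℝ), h (γ t) ≤ φ t) :
    inner ℝ v d ≤ c := by
  have key : ∀ ε : ℝ, 0 < ε → inner ℝ v d - ε * ‖d‖ ≤ c := by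
    intro ε hε
    have hγt : Tendsto γ (𝓝[>] 0) (𝓝 x) := by
      rw [← hγ0]; exact hγ.continuousAt.tendsto.mono_left nhdsWithin_le_nhds
    have h1 : Tendsto (fun t : ℝ => t⁻¹ • (γ t - x)) (𝓝[>] 0) (𝓝 d) := by
      have := hγ.tendsto_slope_zero_right
      simpa [hγ0] using this
    have h2 : Tendsto (fun t : ℝ => t⁻¹ • (φ t - φ 0)) (𝓝[>] 0) (𝓝 c) := by
      have := hφ.tendsto_slope_zero_right
      simpa using this
    have h3 : Tendsto (fun t : ℝ => inner ℝ v (t⁻¹ • (γ t - x)) - ε * ‖t⁻¹ • (γ t - x)‖)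
        (𝓝[>] 0) (𝓝 (inner ℝ v d - ε * ‖d‖)) :=
      (tendsto_const_nhds.inner h1).sub (h1.norm.const_mul ε)
    refine le_of_tendsto_of_tendsto h3 h2 ?_
    filter_upwards [hγt.eventually (hv.2.2 ε hε), hle, self_mem_nhdsWithin] with t ht1 ht2 ht3
    have ht : 0 < t := ht3
    have := ht1.trans ht2
    rw [hφ0, ← EReal.coe_add, EReal.coe_le_coe_iff] at this
    rw [inner_smul_right, norm_smul, Real.norm_eq_abs, abs_of_pos (inv_pos.2 ht), smul_eq_mul]
    have h4 : t⁻¹ * (inner ℝ v (γ t - x) - ε * ‖γ t - x‖) ≤ t⁻¹ * (φ t - φ 0) :=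
      mul_le_mul_of_nonneg_left (by linarith) (inv_pos.2 ht).le
    linarith
  refine le_of_forall_pos_le_add fun δ hδ => ?_
  have := key (δ / (‖d‖ + 1)) (by positivity)
  have h2 : δ / (‖d‖ + 1) * ‖d‖ ≤ δ := by
    rw [div_mul_eq_mul_div, div_le_iff₀ (by positivity)]
    nlinarith
  linarith

theorem mem_regSubdiff_coe_iff {g : E → ℝ} {x v : E} :
    v ∈ regSubdiff (fun y => (g y : EReal)) x ↔ ∀ ε : ℝ, 0 < ε → ∀ᶠ y in 𝓝 x,
      g x + (inner ℝ v (y - x) - ε * ‖y - x‖) ≤ g y := by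
  constructor
  · rintro ⟨-, -, h⟩ ε hε
    filter_upwards [h ε hε] with y hy
    exact_mod_cast hy
  · intro h
    refine ⟨EReal.coe_ne_top _, EReal.coe_ne_bot _, fun ε hε => ?_⟩
    filter_upwards [h ε hε] with y hy
    exact_mod_cast hy

theorem mem_regSubdiff_indicatorFn_iff {Δ : Set E} {x v : E} :
    v ∈ regSubdiff (indicatorFn Δ) x ↔ x ∈ Δ ∧ ∀ ε : ℝ, 0 < ε → ∀ᶠ y in 𝓝 x,
      y ∈ Δ → inner ℝ v (y - x) ≤ ε * ‖y - x‖ := by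
  constructor
  · rintro ⟨h1, -, h⟩
    have hx : x ∈ Δ := by
      by_contra hx
      exact h1 (by simp [indicatorFn, hx])
    refine ⟨hx, fun ε hε => ?_⟩
    filter_upwards [h ε hε] with y hy hyΔ
    simp only [indicatorFn, hx, hyΔ, if_true, zero_add] at hy
    have : inner ℝ v (y - x) - ε * ‖y - x‖ ≤ 0 := by exact_mod_cast hy
    linarith
  · rintro ⟨hx, h⟩
    refine ⟨by simp [indicatorFn, hx], by simp [indicatorFn, hx], fun ε hε => ?_⟩
    filter_upwards [h ε hε] with y hy
    by_cases hyΔ : y ∈ Δ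
    · simp only [indicatorFn, hx, hyΔ, if_true, zero_add]
      have : inner ℝ v (y - x) - ε * ‖y - x‖ ≤ 0 := by linarith [hy hyΔ]
      exact_mod_cast this
    · simp [indicatorFn, hyΔ]

/-- The convergence of function values is automatic: an indicator vanishes wherever it has a regular
subgradient. -/
theorem mem_normalCone_iff {Δ : Set E} {x v : E} : v ∈ normalCone Δ x ↔ x ∈ Δ ∧
    ∃ xs vs : ℕ → E, Tendsto xs atTop (𝓝 x) ∧
      (∀ k, vs k ∈ regSubdiff (indicatorFn Δ) (xs k)) ∧ Tendsto vs atTop (𝓝 v) := by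
  constructor
  · rintro ⟨h1, -, xs, vs, h2, -, h3, h4⟩
    refine ⟨?_, xs, vs, h2, h3, h4⟩
    by_contra hx
    exact h1 (by simp [indicatorFn, hx])
  · rintro ⟨hx, xs, vs, h2, h3, h4⟩
    refine ⟨by simp [indicatorFn, hx], by simp [indicatorFn, hx], xs, vs, h2, ?_, h3, h4⟩
    have : ∀ k, indicatorFn Δ (xs k) = indicatorFn Δ x := fun k => by
      simp [indicatorFn, hx, (mem_regSubdiff_indicatorFn_iff.1 (h3 k)).1]
    simp only [this]
    exact tendsto_const_nhds

theorem mem_normalCone_of_eventually_le_sq {Δ : Set E} {x v : E} (hx : x ∈ Δ) (C : ℝ)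
    (h : ∀ᶠ y in 𝓝 x, y ∈ Δ → inner ℝ v (y - x) ≤ C * ‖y - x‖ ^ 2) : v ∈ normalCone Δ x := by
  refine regSubdiff_subset_limSubdiff _ _ (mem_regSubdiff_indicatorFn_iff.2 ⟨hx, fun ε hε => ?_⟩)
  have hb : ∀ᶠ y in 𝓝 x, ‖y - x‖ < ε / (|C| + 1) := by
    filter_upwards [Metric.ball_mem_nhds x (by positivity : 0 < ε / (|C| + 1))] with y hy
    rwa [Metric.mem_ball, dist_eq_norm] at hy
  filter_upwards [h, hb] with y hy hyb hyΔ
  rw [lt_div_iff₀ (by positivity)] at hyb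
  have hn := norm_nonneg (y - x)
  have hC := le_abs_self C
  calc _ ≤ C * ‖y - x‖ ^ 2 := hy hyΔ
    _ ≤ (|C| + 1) * ‖y - x‖ * ‖y - x‖ := by nlinarith [sq_nonneg ‖y - x‖]
    _ ≤ ε * ‖y - x‖ := by gcongr; linarith

theorem mem_normalCone_of_forall_inner_le {Δ : Set E} {x v : E} (hx : x ∈ Δ)
    (h : ∀ y ∈ Δ, inner ℝ v (y - x) ≤ 0) : v ∈ normalCone Δ x :=
  mem_normalCone_of_eventually_le_sq hx 0 (Eventually.of_forall fun y hy => by simpa using h y hy)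

/-- Regular normals are tested along the segments towards `y`; the resulting inequality is closed
under limits. -/
theorem inner_le_of_mem_normalCone {Δ : Set E} (hΔ : Convex ℝ Δ) {x v : E}
    (hv : v ∈ normalCone Δ x) {y : E} (hy : y ∈ Δ) : inner ℝ v (y - x) ≤ 0 := by
  obtain ⟨-, xs, vs, h1, h2, h3⟩ := mem_normalCone_iff.1 hv
  refine le_of_tendsto (h3.inner (tendsto_const_nhds.sub h1)) (Eventually.of_forall fun k => ?_)
  have hk := (mem_regSubdiff_indicatorFn_iff.1 (h2 k)).1
  have hγ : HasDerivAt (fun t : ℝ => xs k + t • (y - xs k)) (y - xs k) 0 := by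
    simpa using ((hasDerivAt_id (0 : ℝ)).smul_const (y - xs k)).const_add (xs k)
  refine inner_le_of_mem_regSubdiff (h2 k) hγ (by simp) (hasDerivAt_const 0 (0 : ℝ))
    (by simp [indicatorFn, hk]) ?_
  filter_upwards [Ioo_mem_nhdsGT (zero_lt_one : (0 : ℝ) < 1)] with t ht
  have : xs k + t • (y - xs k) ∈ Δ :=
    hΔ.add_smul_sub_mem hk hy ⟨ht.1.le, ht.2.le⟩
  simp [indicatorFn, this]

/-- The chain rule for regular subgradients. -/
theorem mem_regSubdiff_comp {h : E' → EReal} {F : E → E'} {L : E →L[ℝ] E'} {x w : E} {v : E'}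
    (hF : HasFDerivAt F L x) (hv : v ∈ regSubdiff h (F x))
    (hw : ∀ d, inner ℝ w d = inner ℝ v (L d)) : w ∈ regSubdiff (fun y => h (F y)) x := by
  refine ⟨hv.1, hv.2.1, fun ε hε => ?_⟩
  obtain ⟨C, hC, hCb⟩ := hF.isBigO_sub.exists_pos
  have hlo := (hasFDerivAt_iff_isLittleO.1 hF).def
    (by positivity : 0 < ε / 2 / (‖v‖ + 1))
  filter_upwards [hF.continuousAt.tendsto.eventually (hv.2.2 (ε / 2 / C) (by positivity)),
    hCb.bound, hlo] with y h1 h2 h3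
  refine le_trans (add_le_add_right (EReal.coe_le_coe_iff.2 ?_) _) h1
  have e : inner ℝ v (F y - F x) = inner ℝ w (y - x)
      + inner ℝ v (F y - F x - L (y - x)) := by
    rw [hw, ← inner_add_right]; congr 1; abel
  have h4 : |inner ℝ v (F y - F x - L (y - x))| ≤ ε / 2 * ‖y - x‖ := by
    calc _ ≤ ‖v‖ * ‖F y - F x - L (y - x)‖ := abs_real_inner_le_norm _ _
      _ ≤ ‖v‖ * (ε / 2 / (‖v‖ + 1) * ‖y - x‖) := by gcongr
      _ = (‖v‖ / (‖v‖ + 1)) * (ε / 2 * ‖y - x‖) := by ring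
      _ ≤ 1 * (ε / 2 * ‖y - x‖) := by
        gcongr
        rw [div_le_one (by positivity)]; linarith
      _ = _ := one_mul _
  have h5 : ε / 2 / C * ‖F y - F x‖ ≤ ε / 2 * ‖y - x‖ := by
    calc _ ≤ ε / 2 / C * (C * ‖y - x‖) := by gcongr
      _ = _ := by field_simp
  have := (abs_le.1 h4).1
  linarith

end Subdifferential

/-! ### Subgradients of the negative spectral norm and of its composition with the Gram map -/

section SpectralSubgradient

open Filter

variable {m p : ℕ}

theorem mem_regSubdiff_of_eventually_sub_sq_le {E : Type*} [NormedAddCommGroup E] [InnerProductSpace ℝ E]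
    {g : E → ℝ} {x v : E} (C : ℝ)
    (h : ∀ᶠ y in 𝓝 x, g x + inner ℝ v (y - x) - C * ‖y - x‖ ^ 2 ≤ g y) :
    v ∈ regSubdiff (fun y => (g y : EReal)) x := by
  rw [mem_regSubdiff_coe_iff]
  intro ε hε
  have hb : ∀ᶠ y in 𝓝 x, ‖y - x‖ < ε / (|C| + 1) := by
    filter_upwards [Metric.ball_mem_nhds x (by positivity : 0 < ε / (|C| + 1))] with y hy
    rwa [Metric.mem_ball, dist_eq_norm] at hy
  filter_upwards [h, hb] with y hy hyb
  rw [lt_div_iff₀ (by positivity)] at hyb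
  have hn := norm_nonneg (y - x)
  have hC := le_abs_self C
  have : C * ‖y - x‖ ^ 2 ≤ ε * ‖y - x‖ := calc
    C * ‖y - x‖ ^ 2 ≤ (|C| + 1) * ‖y - x‖ * ‖y - x‖ := by nlinarith [sq_nonneg ‖y - x‖]
    _ ≤ ε * ‖y - x‖ := by gcongr; linarith
  linarith

theorem specNorm_add_smul_outer_eq {X : Sym p} {u : EuclideanSpace ℝ (Fin p)} (hu : ‖u‖ = 1)
    (h : inner ℝ (outer u) X = specNorm X) {t : ℝ} (ht : 0 < t) :
    specNorm (X + t • outer u) = inner ℝ (outer u) (X + t • outer u) := by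
  refine le_antisymm ?_ ?_
  · simpa using (specNorm_add_smul_outer hu h ht).self_of_nhds
  · have := (le_abs_self _).trans (abs_inner_outer_le u (X + t • outer u))
    rwa [hu, one_pow, mul_one] at this

theorem neg_outer_mem_regSubdiff_psi {X : Sym p} {u : EuclideanSpace ℝ (Fin p)} (hu : ‖u‖ = 1)
    (h : inner ℝ (outer u) X = specNorm X) {t : ℝ} (ht : 0 < t) :
    -outer u ∈ regSubdiff psi (X + t • outer u) := by
  refine mem_regSubdiff_of_eventually_sub_sq_le (2 / t) ?_
  filter_upwards [specNorm_add_smul_outer hu h ht] with Y hY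
  rw [specNorm_add_smul_outer_eq hu h ht, inner_neg_left, inner_sub_right]
  linarith

theorem continuous_psi : Continuous (psi : Sym p → EReal) :=
  continuous_coe_real_ereal.comp continuous_specNorm.neg

/-- When the top eigenvalue is multiple, `ψ` may have no regular subgradient at `X`; the points `X +
t u uᵀ` with `t ↓ 0` supply the limiting one. -/
theorem neg_outer_mem_limSubdiff_psi {X : Sym p} {u : EuclideanSpace ℝ (Fin p)} (hu : ‖u‖ = 1)
    (h : inner ℝ (outer u) X = specNorm X) : -outer u ∈ limSubdiff psi X := by
  have hx : Tendsto (fun k : ℕ => X + (1 / ((k : ℝ) + 1)) • outer u) atTop (𝓝 X) := by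
    have := (tendsto_one_div_add_atTop_nhds_zero_nat (𝕜 := ℝ)).smul_const (outer u)
    simpa using this.const_add X
  exact ⟨EReal.coe_ne_top _, EReal.coe_ne_bot _, _, fun _ => -outer u, hx,
    (continuous_psi.tendsto X).comp hx,
    fun k => neg_outer_mem_regSubdiff_psi hu h Nat.one_div_pos_of_nat, tendsto_const_nhds⟩

theorem eq_of_forall_inner_le {E : Type*} [NormedAddCommGroup E] [InnerProductSpace ℝ E]
    {v w : E} (h : ∀ d, inner ℝ v d ≤ inner ℝ w d) : v = w := by
  have := h (v - w)
  rw [← sub_nonpos, ← inner_sub_left, real_inner_self_eq_norm_sq] at this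
  have h0 : ‖v - w‖ = 0 := by
    apply pow_eq_zero_iff two_ne_zero |>.1
    exact le_antisymm this (sq_nonneg _)
  exact sub_eq_zero.1 (norm_eq_zero.1 h0)

/-- The linear function `-s ⟨u uᵀ, ·⟩` majorizes `ψ` and touches it at `Y`, which bounds `⟨W, d⟩` in
every direction `d`. The sign `s` covers the case where the norm is attained at a negative
eigenvalue. -/
theorem eq_of_mem_regSubdiff_psi {Y W : Sym p} (hW : W ∈ regSubdiff psi Y) {s : ℝ}
    (hs : |s| = 1) {u : EuclideanSpace ℝ (Fin p)} (hu : ‖u‖ = 1)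
    (h : s * inner ℝ (outer u) Y = specNorm Y) : W = -(s • outer u) := by
  refine eq_of_forall_inner_le fun d => ?_
  have hγ : HasDerivAt (fun t : ℝ => Y + t • d) d 0 := by
    simpa using ((hasDerivAt_id (0 : ℝ)).smul_const d).const_add Y
  have hφ : HasDerivAt (fun t : ℝ => -specNorm Y + t * inner ℝ (-(s • outer u)) d)
      (inner ℝ (-(s • outer u)) d) 0 := by
    simpa using ((hasDerivAt_id (0 : ℝ)).mul_const
      (inner ℝ (-(s • outer u)) d)).const_add (-specNorm Y)
  refine inner_le_of_mem_regSubdiff hW hγ (by simp) hφ (by simp [psi]) ?_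
  refine Eventually.of_forall fun t => EReal.coe_le_coe_iff.2 ?_
  have h1 : s * inner ℝ (outer u) (Y + t • d) ≤ specNorm (Y + t • d) := by
    have := abs_inner_outer_le u (Y + t • d)
    rw [hu, one_pow, mul_one] at this
    refine (le_abs_self _).trans ?_
    rwa [abs_mul, hs, one_mul]
  rw [inner_add_right, sym_inner_smul_right] at h1
  rw [inner_neg_left, sym_inner_smul_left]
  linarith

/-- The sign is taken in the unit sphere of `ℝ`, so that signs and vectors range over one compact
set. -/
theorem exists_sign_mul_inner_outer_eq (hp : 0 < p) (X : Sym p) :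
    ∃ q ∈ Metric.sphere (0 : ℝ) 1 ×ˢ Metric.sphere (0 : EuclideanSpace ℝ (Fin p)) 1,
      q.1 * inner ℝ (outer q.2) X = specNorm X := by
  obtain ⟨u, hu, h⟩ := exists_specNorm_eq hp X
  rcases abs_choice (inner ℝ (outer u) X) with h' | h'
  · exact ⟨(1, u), by simp [hu], by simp only []; linarith⟩
  · exact ⟨(-1, u), by simp [hu], by simp only []; linarith⟩

theorem exists_of_mem_limSubdiff_psi (hp : 0 < p) {X W : Sym p} (hX : (smat X).PosSemidef)
    (hX0 : 0 < specNorm X) (hW : W ∈ limSubdiff psi X) :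
    ∃ u : EuclideanSpace ℝ (Fin p), ‖u‖ = 1 ∧ inner ℝ (outer u) X = specNorm X ∧
      W = -outer u := by
  obtain ⟨-, -, xs, vs, hx, -, hreg, hv⟩ := hW
  choose q hq hqe using fun k => exists_sign_mul_inner_outer_eq hp (xs k)
  obtain ⟨⟨s, u⟩, hsu, φ, hφ, hlim⟩ :=
    ((isCompact_sphere (0 : ℝ) 1).prod
      (isCompact_sphere (0 : EuclideanSpace ℝ (Fin p)) 1)).tendsto_subseq hq
  have hs1 : |s| = 1 := by simpa using hsu.1
  have hu : ‖u‖ = 1 := by simpa using hsu.2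
  have hxφ := hx.comp hφ.tendsto_atTop
  have hvφ := hv.comp hφ.tendsto_atTop
  have h1 : Tendsto (fun k => (q (φ k)).1) atTop (𝓝 s) := hlim.fst_nhds
  have h2 : Tendsto (fun k => outer (q (φ k)).2) atTop (𝓝 (outer u)) :=
    (continuous_outer.tendsto u).comp hlim.snd_nhds
  have he : s * inner ℝ (outer u) X = specNorm X := by
    refine tendsto_nhds_unique (h1.mul (h2.inner hxφ)) ?_
    refine ((continuous_specNorm.tendsto X).comp hxφ).congr fun k => ?_
    exact (hqe (φ k)).symm
  have hWe : W = -(s • outer u) := by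
    refine tendsto_nhds_unique hvφ ((h1.smul h2).neg.congr fun k => ?_)
    refine (eq_of_mem_regSubdiff_psi (hreg (φ k)) ?_ ?_ (hqe (φ k))).symm
    · simpa using (hq (φ k)).1
    · simpa using (hq (φ k)).2
  have hnn := (posSemidef_iff_inner_outer X).1 hX u
  -- The limit sign `-1` would make the form of the positive semidefinite `X` equal to `-‖X‖ < 0` at
  -- `u`.
  have hs : s = 1 := by
    rcases abs_choice s with h | h
    · linarith
    · have : s = -1 := by linarith
      rw [this] at he
      linarith
  subst hs
  exact ⟨u, hu, by linarith, by rw [hWe, one_smul]⟩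

/-- `V W`. -/
def mulSym (V : RMat m p) (W : Sym p) : RMat m p := ofMat (mat V * smat W)

theorem mat_mulSym (V : RMat m p) (W : Sym p) : mat (mulSym V W) = mat V * smat W := rfl

theorem rmat_ext {A B : RMat m p} (h : mat A = mat B) : A = B := by
  ext ⟨i, j⟩
  exact congrFun (congrFun h i) j

theorem mat_add (A B : RMat m p) : mat (A + B) = mat A + mat B := rfl

theorem mat_smul (c : ℝ) (A : RMat m p) : mat (c • A) = c • mat A := rfl

theorem mulSym_add (V : RMat m p) (W W' : Sym p) :
    mulSym V (W + W') = mulSym V W + mulSym V W' :=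
  rmat_ext (by simp only [mat_mulSym, mat_add, smat_add, Matrix.mul_add])

theorem mulSym_smul (V : RMat m p) (c : ℝ) (W : Sym p) : mulSym V (c • W) = c • mulSym V W :=
  rmat_ext (by simp only [mat_mulSym, mat_smul, smat_smul, Matrix.mul_smul])

theorem mulSym_idMat (V : RMat m p) : mulSym V (idMat p) = V :=
  rmat_ext (by rw [mat_mulSym, smat_idMat, Matrix.mul_one])

theorem continuous_mulSym :
    Continuous fun q : RMat m p × Sym p => mulSym q.1 q.2 := by
  apply (PiLp.continuous_toLp 2 _).comp
  refine continuous_pi fun ij => ?_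
  simp only [Matrix.mul_apply, mat_apply]
  fun_prop

/-- The derivative of `V ↦ VᵀV`. -/
noncomputable def dgram (V : RMat m p) : RMat m p →L[ℝ] Sym p :=
  LinearMap.toContinuousLinearMap
    { toFun := fun D => mkSym ((mat V).transpose * mat D + (mat D).transpose * mat V) (by
        rw [Matrix.IsSymm, Matrix.transpose_add, Matrix.transpose_mul, Matrix.transpose_mul,
          Matrix.transpose_transpose, Matrix.transpose_transpose, add_comm])
      map_add' := fun A B => sym_ext fun i j => by
        change ((mat V).transpose * mat (A + B) + (mat (A + B)).transpose * mat V) i j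
          = (((mat V).transpose * mat A + (mat A).transpose * mat V)
            + ((mat V).transpose * mat B + (mat B).transpose * mat V)) i j
        rw [mat_add, Matrix.mul_add, Matrix.transpose_add, Matrix.add_mul, add_add_add_comm]
      map_smul' := fun c A => sym_ext fun i j => by
        change ((mat V).transpose * mat (c • A) + (mat (c • A)).transpose * mat V) i j
          = (c • ((mat V).transpose * mat A + (mat A).transpose * mat V)) i j
        rw [mat_smul, Matrix.mul_smul, Matrix.transpose_smul, Matrix.smul_mul, smul_add] }

theorem smat_dgram (V D : RMat m p) :
    smat (dgram V D) = (mat V).transpose * mat D + (mat D).transpose * mat V := rfl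

theorem gram_add (V D : RMat m p) : gram (V + D) = gram V + dgram V D + gram D := by
  refine sym_ext fun i j => ?_
  rw [smat_add, smat_add, smat_gram, smat_gram, smat_gram, smat_dgram, mat_add,
    Matrix.transpose_add, Matrix.add_mul, Matrix.mul_add, Matrix.mul_add]
  simp only [Matrix.add_apply]
  ring

theorem gram_smul (c : ℝ) (D : RMat m p) : gram (c • D) = c ^ 2 • gram D := by
  refine sym_ext fun i j => ?_
  rw [smat_smul, smat_gram, smat_gram, mat_smul, Matrix.transpose_smul, Matrix.smul_mul,
    Matrix.mul_smul, smul_smul, sq]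

theorem norm_gram_le (D : RMat m p) : ‖gram D‖ ≤ ‖D‖ ^ 2 := by
  refine (norm_le_trace_of_posSemidef (gram_posSemidef D)).trans_eq ?_
  rw [rmat_norm_sq, Finset.sum_comm]
  simp only [smat_gram, Matrix.mul_apply, Matrix.transpose_apply, sq]

/-- The adjoint of the derivative of the Gram map is `W ↦ 2 V W`; this is the source of the factors
`2` below. -/
theorem inner_dgram (W : Sym p) (V D : RMat m p) :
    inner ℝ W (dgram V D) = inner ℝ ((2 : ℝ) • mulSym V W) D := by
  have h1 : inner ℝ W (dgram V D) = ((smat W).transpose * smat (dgram V D)).trace :=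
    inner_eq_trace (W : RMat p p) (dgram V D : RMat p p)
  have hW : (smat W).transpose = smat W := W.2
  rw [h1, real_inner_smul_left, inner_eq_trace, mat_mulSym, smat_dgram, hW, Matrix.mul_add,
    Matrix.trace_add, Matrix.transpose_mul, hW, Matrix.mul_assoc, two_mul]
  congr 1
  rw [← Matrix.trace_transpose, Matrix.transpose_mul, Matrix.transpose_mul,
    Matrix.transpose_transpose, hW, Matrix.trace_mul_comm]

theorem hasFDerivAt_gram (V : RMat m p) : HasFDerivAt gram (dgram V) V := by
  rw [hasFDerivAt_iff_isLittleO_nhds_zero]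
  have h : (fun D : RMat m p => gram (V + D) - gram V - dgram V D) = gram := by
    funext D; rw [gram_add]; abel
  rw [h]
  refine Asymptotics.IsBigO.trans_isLittleO (g := fun D : RMat m p => ‖D‖ ^ 2) ?_ ?_
  · refine Asymptotics.IsBigO.of_bound 1 (Eventually.of_forall fun D => ?_)
    rw [one_mul, norm_pow, norm_norm]
    exact norm_gram_le D
  · exact Asymptotics.isLittleO_norm_pow_id one_lt_two

theorem continuous_gram : Continuous (gram : RMat m p → Sym p) :=
  continuous_iff_continuousAt.2 fun V => (hasFDerivAt_gram V).continuousAt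

theorem hasGradientAt_comp_gram {f : Sym p → ℝ} {V : RMat m p}
    (hf : DifferentiableAt ℝ f (gram V)) :
    HasGradientAt (fun U : RMat m p => f (gram U)) ((2 : ℝ) • mulSym V (∇ f (gram V))) V := by
  rw [hasGradientAt_iff_hasFDerivAt]
  have := hf.hasGradientAt.hasFDerivAt.comp V (hasFDerivAt_gram V)
  refine this.congr_fderiv ?_
  ext D
  simp only [ContinuousLinearMap.comp_apply, InnerProductSpace.toDual_apply_apply, inner_dgram]

theorem continuous_psiTilde : Continuous (psiTilde : RMat m p → EReal) :=
  continuous_psi.comp continuous_gram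

/-- The touching majorant is now the smooth function `-⟨u uᵀ, VᵀV⟩`. No sign is needed, since Gram
matrices are positive semidefinite. -/
theorem eq_of_mem_regSubdiff_psiTilde {V G : RMat m p} (hG : G ∈ regSubdiff psiTilde V)
    {u : EuclideanSpace ℝ (Fin p)} (hu : ‖u‖ = 1)
    (h : inner ℝ (outer u) (gram V) = specNorm (gram V)) :
    G = (2 : ℝ) • mulSym V (-outer u) := by
  refine eq_of_forall_inner_le fun d => ?_
  have hγ : HasDerivAt (fun t : ℝ => V + t • d) d 0 := by
    simpa using ((hasDerivAt_id (0 : ℝ)).smul_const d).const_add V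
  rw [← inner_dgram]
  have hφ : HasDerivAt (fun t : ℝ => inner ℝ (-outer u) (gram (V + t • d)))
      (inner ℝ (-outer u) (dgram V d)) 0 := by
    have hV : V = V + (0 : ℝ) • d := by simp
    have h1 : HasFDerivAt (gram : RMat m p → Sym p) (dgram V) (V + (0 : ℝ) • d) := by
      rw [← hV]; exact hasFDerivAt_gram V
    simpa using (hasDerivAt_const (0 : ℝ) (-outer u)).inner ℝ (h1.comp_hasDerivAt (0 : ℝ) hγ)
  refine inner_le_of_mem_regSubdiff hG hγ (by simp) hφ ?_ ?_
  · rw [zero_smul, add_zero, inner_neg_left, h]; rfl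
  refine Eventually.of_forall fun t => EReal.coe_le_coe_iff.2 ?_
  have h1 := (le_abs_self _).trans (abs_inner_outer_le u (gram (V + t • d)))
  rw [hu, one_pow, mul_one] at h1
  rw [inner_neg_left]
  linarith

theorem exists_of_mem_limSubdiff_psiTilde (hp : 0 < p) {V G : RMat m p}
    (hG : G ∈ limSubdiff psiTilde V) :
    ∃ u : EuclideanSpace ℝ (Fin p), ‖u‖ = 1 ∧
      inner ℝ (outer u) (gram V) = specNorm (gram V) ∧ G = (2 : ℝ) • mulSym V (-outer u) := by
  obtain ⟨-, -, xs, vs, hx, -, hreg, hv⟩ := hG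
  choose q hq hqe using fun k =>
    exists_inner_outer_eq_specNorm hp (gram_posSemidef (xs k))
  obtain ⟨u, hu, φ, hφ, hlim⟩ :=
    (isCompact_sphere (0 : EuclideanSpace ℝ (Fin p)) 1).tendsto_subseq
      (x := q) (fun k => by simp [hq k])
  have hxφ := hx.comp hφ.tendsto_atTop
  have hvφ := hv.comp hφ.tendsto_atTop
  have h2 : Tendsto (fun k => outer (q (φ k))) atTop (𝓝 (outer u)) :=
    (continuous_outer.tendsto u).comp hlim
  have hgr : Tendsto (fun k => gram (xs (φ k))) atTop (𝓝 (gram V)) :=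
    (continuous_gram.tendsto V).comp hxφ
  refine ⟨u, by simpa using hu, ?_, ?_⟩
  · refine tendsto_nhds_unique (h2.inner hgr) ?_
    exact ((continuous_specNorm.tendsto _).comp hgr).congr fun k => (hqe (φ k)).symm
  · refine tendsto_nhds_unique hvφ ?_
    have h3 : Tendsto (fun k => (2 : ℝ) • mulSym (xs (φ k)) (-outer (q (φ k)))) atTop
        (𝓝 ((2 : ℝ) • mulSym V (-outer u))) :=
      ((continuous_mulSym.tendsto (V, -outer u)).comp (hxφ.prodMk_nhds h2.neg)).const_smul _
    exact h3.congr fun k => (eq_of_mem_regSubdiff_psiTilde (hreg (φ k)) (hq _) (hqe _)).symm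

/-- As `u` is an eigenvector of `VᵀV`, the direction `V u uᵀ` moves the Gram matrix purely along `u
uᵀ`, separating its top eigenvalue. -/
theorem gram_add_smul_mulSym_outer {V : RMat m p} {u : EuclideanSpace ℝ (Fin p)} (hu : ‖u‖ = 1)
    (h : inner ℝ (outer u) (gram V) = specNorm (gram V)) (t : ℝ) :
    gram (V + t • mulSym V (outer u))
      = gram V + ((2 * t + t ^ 2) * specNorm (gram V)) • outer u := by
  have hop := opOf_eq_of_inner_eq hu h
  have hu2 : ∑ i, u i * u i = 1 := by
    have := EuclideanSpace.norm_sq_eq u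
    simp only [Real.norm_eq_abs, sq_abs, hu, one_pow] at this
    rw [this]
    exact Finset.sum_congr rfl fun i _ => (sq _).symm
  have hX : smat (gram V) * smat (outer u) = specNorm (gram V) • smat (outer u) := by
    ext i j
    have hi : ∑ k, smat (gram V) i k * u k = specNorm (gram V) * u i := by
      rw [← opOf_apply, hop]; rfl
    rw [Matrix.mul_apply, Matrix.smul_apply, smat_outer, smul_eq_mul, ← mul_assoc, ← hi,
      Finset.sum_mul]
    exact Finset.sum_congr rfl fun k _ => by rw [smat_outer]; ring
  have hX' : smat (outer u) * smat (gram V) = specNorm (gram V) • smat (outer u) := by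
    have := congrArg Matrix.transpose hX
    rwa [Matrix.transpose_mul, Matrix.transpose_smul, (outer u).2, (gram V).2] at this
  have hO : smat (outer u) * smat (outer u) = smat (outer u) := by
    ext i j
    rw [Matrix.mul_apply, smat_outer]
    calc _ = ∑ k, (u k * u k) * (u i * u j) :=
          Finset.sum_congr rfl fun k _ => by rw [smat_outer, smat_outer]; ring
      _ = _ := by rw [← Finset.sum_mul, hu2, one_mul]
  have hOt : (smat (outer u)).transpose = smat (outer u) := (outer u).2
  have h1 : dgram V (mulSym V (outer u)) = (2 * specNorm (gram V)) • outer u := by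
    refine sym_ext fun i j => ?_
    rw [smat_dgram, mat_mulSym, Matrix.transpose_mul, hOt, ← Matrix.mul_assoc,
      Matrix.mul_assoc (smat (outer u)), ← smat_gram, hX, hX', smat_smul, ← add_smul, two_mul]
  have h2 : gram (mulSym V (outer u)) = specNorm (gram V) • outer u := by
    refine sym_ext fun i j => ?_
    rw [smat_gram, mat_mulSym, Matrix.transpose_mul, hOt, Matrix.mul_assoc,
      ← Matrix.mul_assoc (mat V).transpose, ← smat_gram, hX, Matrix.mul_smul, hO, smat_smul]
  rw [gram_add, map_smul, h1, gram_smul, h2]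
  module

/-- The chain rule applies at the perturbed points, where `-u uᵀ` is a regular subgradient of `ψ`.
Positivity of the norm keeps the shift along `u uᵀ` positive. -/
theorem mem_limSubdiff_psiTilde {V : RMat m p} (hV : 0 < specNorm (gram V))
    {u : EuclideanSpace ℝ (Fin p)} (hu : ‖u‖ = 1)
    (h : inner ℝ (outer u) (gram V) = specNorm (gram V)) :
    (2 : ℝ) • mulSym V (-outer u) ∈ limSubdiff psiTilde V := by
  have hx : Tendsto (fun k : ℕ => V + (1 / ((k : ℝ) + 1)) • mulSym V (outer u)) atTop (𝓝 V) := by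
    have := (tendsto_one_div_add_atTop_nhds_zero_nat (𝕜 := ℝ)).smul_const (mulSym V (outer u))
    simpa using this.const_add V
  refine ⟨EReal.coe_ne_top _, EReal.coe_ne_bot _, _, _, hx,
    (continuous_psiTilde.tendsto V).comp hx, fun k => ?_,
    ((continuous_mulSym.tendsto (V, -outer u)).comp
      (hx.prodMk_nhds tendsto_const_nhds)).const_smul (2 : ℝ)⟩
  refine mem_regSubdiff_comp (h := psi) (v := (-outer u : Sym p)) (hasFDerivAt_gram _) ?_
    fun d => (inner_dgram _ _ _).symm
  rw [gram_add_smul_mulSym_outer hu h]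
  refine neg_outer_mem_regSubdiff_psi hu h ?_
  have : (0 : ℝ) < 1 / ((k : ℝ) + 1) := Nat.one_div_pos_of_nat
  positivity

end SpectralSubgradient

end DCSDP

namespace DCSDP

/-! ### Normal cones of the constraint sets and stationarity of the three problems -/

section Stationary

open Filter

variable {m p : ℕ}

theorem convex_Omega (p : ℕ) : Convex ℝ (Omega p) := by
  intro X hX Y hY a b ha hb hab
  refine ⟨(posSemidef_iff_inner_outer _).2 fun u => ?_, fun i => ?_⟩
  · rw [inner_add_right, sym_inner_smul_right, sym_inner_smul_right]
    have h1 := (posSemidef_iff_inner_outer X).1 hX.1 u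
    have h2 := (posSemidef_iff_inner_outer Y).1 hY.1 u
    positivity
  · rw [smat_add, smat_smul, smat_smul, Matrix.add_apply, Matrix.smul_apply, Matrix.smul_apply,
      hX.2, hY.2, smul_eq_mul, smul_eq_mul, mul_one, mul_one, hab]

theorem specNorm_pos_of_mem_Omega (hp : 0 < p) {X : Sym p} (hX : X ∈ Omega p) :
    0 < specNorm X := by
  have := (le_abs_self _).trans
    (abs_inner_outer_le (EuclideanSpace.single ⟨0, hp⟩ (1 : ℝ)) X)
  rw [inner_outer, inner_single_opOf_single, hX.2] at this
  simp only [PiLp.norm_single, norm_one, one_pow, mul_one] at this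
  linarith

theorem inner_diagMat_sub {X Z : Sym p} (hX : X ∈ Omega p) (hZ : Z ∈ Omega p) (y : Fin p → ℝ) :
    inner ℝ (diagMat y) (Z - X) = 0 := by
  rw [inner_sub_right, inner_diagMat, inner_diagMat]
  simp only [hX.2, hZ.2, sub_self]

/-- `⟨Diag y, ·⟩` is constant on `Ω`, whose members have unit diagonal. -/
theorem diagMat_mem_normalCone {X : Sym p} (hX : X ∈ Omega p) (y : Fin p → ℝ) :
    diagMat y ∈ normalCone (Omega p) X :=
  mem_normalCone_of_forall_inner_le hX fun _ hZ => (inner_diagMat_sub hX hZ y).le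

theorem normalCone_feasible (hp : 0 < p) {X : Sym p} (hX : X ∈ feasible p) (v : Sym p) :
    v ∈ normalCone (feasible p) X := by
  refine mem_normalCone_of_eventually_le_sq hX 0 ?_
  filter_upwards [Metric.ball_mem_nhds X zero_lt_one] with Y hY hYf
  rw [Metric.mem_ball, dist_eq_norm] at hY
  rw [eq_of_mem_feasible_of_norm_lt_one hp hYf hX hY]
  simp

theorem outer_opOf_single_of_rank_le_one {Z : Sym p} (hZ : (smat Z).rank ≤ 1) (k : Fin p) :
    outer (opOf Z (EuclideanSpace.single k 1)) = smat Z k k • Z := by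
  refine sym_ext fun i j => ?_
  have h : ∀ i, opOf Z (EuclideanSpace.single k 1) i = smat Z i k := fun i => by
    rw [opOf_apply]; simp
  rw [smat_outer, smat_smul, Matrix.smul_apply, smul_eq_mul, h, h, smat_symm Z j k]
  rw [mul_eq_mul_of_rank_le_one hZ i k k j, mul_comm]

/-- Symmetric matrices annihilating `X` are normal to the matrices of rank at most one. -/
theorem mem_normalCone_rankLeOne (hp : 0 < p) {x : EuclideanSpace ℝ (Fin p)}
    (hx : ∀ i, x i = 1 ∨ x i = -1) {H : Sym p} (hH : opOf H x = 0) :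
    H ∈ normalCone (rankLeOne p) (outer x) := by
  refine mem_normalCone_of_eventually_le_sq (C := 2 * ‖H‖) (Matrix.rank_vecMulVec_le _ _) ?_
  filter_upwards [Metric.ball_mem_nhds (outer x) (by norm_num : (0 : ℝ) < 1 / 2)] with Z hZ hZr
  rw [Metric.mem_ball, dist_eq_norm] at hZ
  set k : Fin p := ⟨0, hp⟩
  set e : EuclideanSpace ℝ (Fin p) := EuclideanSpace.single k 1
  have he : ‖e‖ = 1 := by simp [e]
  set w := opOf (Z - outer x) e
  have hw : ‖w‖ ≤ ‖Z - outer x‖ := by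
    have := ((opOf (Z - outer x)).le_opNorm e).trans
      (mul_le_mul_of_nonneg_right (norm_opOf_le _) (norm_nonneg e))
    rwa [he, mul_one] at this
  have hkk : 1 / 2 ≤ smat Z k k := by
    have h1 := (abs_smat_le_norm (Z - outer x) k k).trans hZ.le
    have h2 : smat (outer x) k k = 1 := (outer_mem_Omega hx).2 k
    rw [smat_sub, Matrix.sub_apply, h2] at h1
    linarith [(abs_le.1 h1).1]
  have hz : opOf Z e = inner ℝ x e • x + w := by
    simp only [w]
    rw [opOf_sub, sub_apply, opOf_outer]; abel
  -- With `z = Z eₖ = xₖ x + w` one has `z zᵀ = Zₖₖ Z`, and `H x = 0` leaves only the term quadratic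
  -- in `w`. Dividing by `Zₖₖ ≥ 1/2` gives the constant `2 ‖H‖`.
  have h1 : smat Z k k * inner ℝ H Z = inner ℝ (outer w) H := by
    rw [← sym_inner_smul_right, ← outer_opOf_single_of_rank_le_one hZr k, real_inner_comm, hz,
      inner_outer_decomp, hH, inner_outer x, hH]
    simp
  have h2 : inner ℝ H (outer x) = 0 := by
    rw [real_inner_comm, inner_outer, hH, inner_zero_right]
  have h3 : |inner ℝ (outer w) H| ≤ ‖H‖ * ‖Z - outer x‖ ^ 2 := by
    refine (abs_inner_outer_le w H).trans ?_
    gcongr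
    exact norm_opOf_le H
  rw [inner_sub_right, h2, sub_zero]
  have h4 := (le_abs_self _).trans h3
  by_contra hcon
  push Not at hcon
  have h5 : 0 ≤ ‖H‖ * ‖Z - outer x‖ ^ 2 := by positivity
  nlinarith

/-- The normal cone to the unit sphere of the columns. -/
theorem exists_of_mem_normalCone_unitCols {V N : RMat m p}
    (hN : N ∈ normalCone (unitCols m p) V) :
    ∃ z : Fin p → ℝ, N = mulSym V (diagMat z) := by
  set col : RMat m p → Fin p → EuclideanSpace ℝ (Fin m) :=
    fun V j => WithLp.toLp 2 fun i => V (i, j)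
  have hcol : ∀ j, Continuous fun V : RMat m p => col V j := fun j => by
    apply (PiLp.continuous_toLp 2 _).comp
    fun_prop
  -- A nonzero tangential part of column `j` of `N` would have positive inner product with the
  -- velocity of a feasible curve: rotate column `j` of `V` along the great circle towards that
  -- part, fixing the other columns.
  have key : ∀ {V N : RMat m p}, N ∈ regSubdiff (indicatorFn (unitCols m p)) V →
      ∀ j, col N j = inner ℝ (col V j) (col N j) • col V j := by
    intro V N hN j
    have hV : V ∈ unitCols m p := (mem_regSubdiff_indicatorFn_iff.1 hN).1
    have hv : ‖col V j‖ = 1 := hV j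
    obtain ⟨a, w, hw, hvw, -⟩ := exists_decomp hv (col N j)
    have ha : inner ℝ (col V j) (col N j) = a := by
      rw [hw, inner_add_right, hvw, inner_smul_right, real_inner_self_eq_norm_sq, hv]; ring
    rw [ha]
    by_contra hne
    have hw0 : w ≠ 0 := by
      rintro rfl
      exact hne (by rw [hw, add_zero])
    have hnw : 0 < ‖w‖ := norm_pos_iff.2 hw0
    set d : EuclideanSpace ℝ (Fin m) := ‖w‖⁻¹ • w
    have hd : ‖d‖ = 1 := by
      simp only [d]
      rw [norm_smul, norm_inv, norm_norm, inv_mul_cancel₀ hnw.ne']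
    have hvd : inner ℝ (col V j) d = 0 := by simp only [d]; rw [inner_smul_right, hvw, mul_zero]
    set emb : EuclideanSpace ℝ (Fin m) → RMat m p :=
      fun c => WithLp.toLp 2 fun ij => if ij.2 = j then c ij.1 else 0
    set γ : ℝ → RMat m p :=
      fun t => V + ((Real.cos t - 1) • emb (col V j) + Real.sin t • emb d)
    have hγ : HasDerivAt γ (emb d) 0 := by
      have h1 := ((Real.hasDerivAt_cos 0).sub_const 1).smul_const (emb (col V j))
      have h2 := (Real.hasDerivAt_sin 0).smul_const (emb d)
      have h3 := (h1.add h2).const_add V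
      simp only [Real.sin_zero, Real.cos_zero, neg_zero, zero_smul, one_smul, zero_add] at h3
      exact h3
    have hγm : ∀ t, γ t ∈ unitCols m p := by
      intro t k
      by_cases hk : k = j
      · subst hk
        have e : WithLp.toLp 2 (fun i => γ t (i, k)) = Real.cos t • col V k + Real.sin t • d := by
          ext i
          simp [γ, emb, col]
          ring
        rw [e]
        have : ‖Real.cos t • col V k + Real.sin t • d‖ ^ 2 = 1 := by
          rw [norm_add_sq_real, inner_smul_left, inner_smul_right, hvd, norm_smul, norm_smul, hv,
            hd]
          simp
        exact (pow_eq_one_iff_of_nonneg (norm_nonneg _) two_ne_zero).1 this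
      · have e : WithLp.toLp 2 (fun i => γ t (i, k)) = col V k := by
          ext i
          simp [γ, emb, col, hk]
        rw [e]
        exact hV k
    have hle := inner_le_of_mem_regSubdiff hN hγ (by simp [γ]) (hasDerivAt_const 0 (0 : ℝ))
      (by simp [indicatorFn, hV]) (Eventually.of_forall fun t => by simp [indicatorFn, hγm t])
    have hemb : inner ℝ N (emb d) = inner ℝ (col N j) d := by
      rw [rmat_inner_eq_sum]
      simp [emb, col, PiLp.inner_apply, mul_comm]
    rw [hemb, hw, inner_add_left, inner_smul_left, hvd] at hle
    simp only [d] at hle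
    rw [inner_smul_right, real_inner_self_eq_norm_sq] at hle
    have : 0 < ‖w‖⁻¹ * ‖w‖ ^ 2 := by positivity
    simp at hle
    linarith
  obtain ⟨-, xs, vs, hx, hreg, hv⟩ := mem_normalCone_iff.1 hN
  have hlim : ∀ j, col N j = inner ℝ (col V j) (col N j) • col V j := by
    intro j
    have h1 := ((hcol j).tendsto V).comp hx
    have h2 := ((hcol j).tendsto N).comp hv
    refine tendsto_nhds_unique h2 (((h1.inner h2).smul h1).congr fun k => ?_)
    exact (key (hreg k) j).symm
  refine ⟨fun j => inner ℝ (col V j) (col N j), rmat_ext ?_⟩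
  ext i j
  rw [mat_mulSym, smat_diagMat, Matrix.mul_diagonal]
  have := congrArg (fun c : EuclideanSpace ℝ (Fin m) => c i) (hlim j)
  simp only [PiLp.smul_apply, smul_eq_mul] at this
  rw [mul_comm]
  exact this

theorem mem_statPen_iff {f : Sym p → ℝ} {ρ : ℝ} {X : Sym p} : X ∈ statPen f ρ ↔
    ∃ W ∈ limSubdiff psi X, ∃ N ∈ normalCone (Omega p) X,
      ∇ f X + ρ • (idMat p + W) + N = 0 := by
  simp only [statPen, Set.mem_ofPred_eq, Set.mem_add, Set.mem_smul_set, Set.mem_singleton_iff]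
  constructor
  · rintro ⟨_, ⟨_, rfl, _, ⟨_, ⟨_, rfl, W, hW, rfl⟩, rfl⟩, rfl⟩, N, hN, h⟩
    exact ⟨W, hW, N, hN, h⟩
  · rintro ⟨W, hW, N, hN, h⟩
    exact ⟨_, ⟨_, rfl, _, ⟨_, ⟨_, rfl, W, hW, rfl⟩, rfl⟩, rfl⟩, N, hN, h⟩

theorem mem_statFac_iff {f : Sym p → ℝ} (hf : Differentiable ℝ f) {ρ : ℝ} {V : RMat m p} :
    V ∈ statFac m f ρ ↔ ∃ G ∈ limSubdiff psiTilde V, ∃ N ∈ normalCone (unitCols m p) V,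
      (2 : ℝ) • mulSym V (∇ f (gram V)) + ρ • ((2 : ℝ) • V + G) + N = 0 := by
  simp only [statFac, Set.mem_ofPred_eq, Set.mem_add, Set.mem_smul_set, Set.mem_singleton_iff,
    (hasGradientAt_comp_gram (hf (gram V))).gradient]
  constructor
  · rintro ⟨_, ⟨_, rfl, _, ⟨_, ⟨_, rfl, W, hW, rfl⟩, rfl⟩, rfl⟩, N, hN, h⟩
    exact ⟨W, hW, N, hN, h⟩
  · rintro ⟨W, hW, N, hN, h⟩
    exact ⟨_, ⟨_, rfl, _, ⟨_, ⟨_, rfl, W, hW, rfl⟩, rfl⟩, rfl⟩, N, hN, h⟩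

theorem mem_Omega_of_mem_statPen {f : Sym p → ℝ} {ρ : ℝ} {X : Sym p} (hX : X ∈ statPen f ρ) :
    X ∈ Omega p := by
  obtain ⟨_, _, N, hN, _⟩ := mem_statPen_iff.1 hX
  exact (mem_normalCone_iff.1 hN).1

theorem Phi_of_mem {f : Sym p → ℝ} {ρ : ℝ} {X : Sym p} (hX : X ∈ Omega p) :
    Phi f ρ X = penObj f ρ X := by
  simp [Phi, indicatorFn, hX]

/-- Regular subgradients of `Φ_ρ` split off the gradient of the smooth part and a supergradient
of the concave part. -/
theorem sub_mem_regSubdiff_indicatorFn {f : Sym p → ℝ} {ρ : ℝ} (hρ : 0 < ρ)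
    {Y v : Sym p} (hf : DifferentiableAt ℝ f Y)
    (hv : v ∈ regSubdiff (Phi f ρ) Y) {u : EuclideanSpace ℝ (Fin p)} (hu : ‖u‖ = 1)
    (h : inner ℝ (outer u) Y = specNorm Y) :
    v - (∇ f Y + ρ • (idMat p + -outer u)) ∈ regSubdiff (indicatorFn (Omega p)) Y := by
  have hY : Y ∈ Omega p := by
    by_contra hY
    exact hv.1 (by simp [Phi, indicatorFn, hY])
  refine mem_regSubdiff_indicatorFn_iff.2 ⟨hY, fun ε hε => ?_⟩
  have hg := (hasGradientAt_iff_isLittleO.1 hf.hasGradientAt).def (half_pos hε)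
  filter_upwards [hv.2.2 (ε / 2) (half_pos hε), hg] with Z h1 h2 hZ
  rw [Phi_of_mem hY, Phi_of_mem hZ, ← EReal.coe_add, EReal.coe_le_coe_iff, penObj, penObj] at h1
  rw [Real.norm_eq_abs] at h2
  have h3 := (abs_le.1 h2).2
  -- Replacing `-ρ ‖Z‖` by `-ρ ⟨u uᵀ, Z⟩` only increases the right-hand side of `h1`, with equality
  -- at `Y`.
  have h4 := (le_abs_self _).trans (abs_inner_outer_le u Z)
  rw [hu, one_pow, mul_one] at h4
  have h5 := mul_le_mul_of_nonneg_left h4 hρ.le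
  rw [inner_sub_left, inner_add_left, sym_inner_smul_left, inner_add_left, inner_neg_left,
    inner_sub_right (idMat p), inner_sub_right (outer u), h]
  linarith

theorem crit_Phi_subset_statPen (hp : 0 < p) {f : Sym p → ℝ} (hf : ContDiff ℝ 1 f) {ρ : ℝ}
    (hρ : 0 < ρ) : crit (Phi f ρ) ⊆ statPen f ρ := by
  rintro X ⟨hX, -, xs, vs, hx, -, hreg, hv⟩
  have hXO : X ∈ Omega p := by
    by_contra h
    exact hX (by simp [Phi, indicatorFn, h])
  have hxO : ∀ k, xs k ∈ Omega p := fun k => by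
    by_contra h
    exact (hreg k).1 (by simp [Phi, indicatorFn, h])
  have hgrad : Continuous (∇ f) :=
    (InnerProductSpace.toDual ℝ (Sym p)).symm.continuous.comp (hf.continuous_fderiv one_ne_zero)
  choose q hq hqe using fun k => exists_inner_outer_eq_specNorm hp (hxO k).1
  obtain ⟨u, hu, φ, hφ, hlim⟩ :=
    (isCompact_sphere (0 : EuclideanSpace ℝ (Fin p)) 1).tendsto_subseq
      (x := q) (fun k => by simp [hq k])
  have hu1 : ‖u‖ = 1 := by simpa using hu
  have hxφ := hx.comp hφ.tendsto_atTop
  have hvφ := hv.comp hφ.tendsto_atTop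
  have h2 : Tendsto (fun k => outer (q (φ k))) atTop (𝓝 (outer u)) :=
    (continuous_outer.tendsto u).comp hlim
  have hue : inner ℝ (outer u) X = specNorm X := by
    refine tendsto_nhds_unique (h2.inner hxφ) ?_
    exact ((continuous_specNorm.tendsto _).comp hxφ).congr fun k => (hqe (φ k)).symm
  refine mem_statPen_iff.2 ⟨-outer u, neg_outer_mem_limSubdiff_psi hu1 hue,
    0 - (∇ f X + ρ • (idMat p + -outer u)), ?_, by abel⟩
  refine mem_normalCone_iff.2 ⟨hXO, _, _, hxφ, fun k =>
    sub_mem_regSubdiff_indicatorFn hρ (hf.differentiable one_ne_zero _) (hreg (φ k)) (hq (φ k))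
      (hqe (φ k)), ?_⟩
  exact hvφ.sub (((hgrad.tendsto X).comp hxφ).add ((h2.neg.const_add _).const_smul ρ))

theorem eigval_nonneg {X : Sym p} (hX : (smat X).PosSemidef) (i : Fin p) : 0 ≤ eigval X i := by
  have := hX.eigenvalues_nonneg
    (Fintype.equivOfCardEq (Fintype.card_fin _) (i.cast (Fintype.card_fin p).symm))
  rwa [Matrix.IsHermitian.eigenvalues, Equiv.symm_apply_apply] at this

/-- The rank counts the nonzero eigenvalues; by the ordering, a positive one at a zero-based index
`i ≥ m` would force at least `m + 1` of them. -/
theorem eigval_eq_zero {X : Sym p} (hX : (smat X).PosSemidef) (hr : (smat X).rank ≤ m)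
    {i : Fin p} (hi : m ≤ i) : eigval X i = 0 := by
  by_contra hne
  have hpos : 0 < eigval X i := lt_of_le_of_ne (eigval_nonneg hX i) (Ne.symm hne)
  rw [(smat_isHermitian X).rank_eq_card_non_zero_eigs] at hr
  let eq : Fin (Fintype.card (Fin p)) ≃ Fin p := Fintype.equivOfCardEq (Fintype.card_fin _)
  let g : Fin (m + 1) → {j // (smat_isHermitian X).eigenvalues j ≠ 0} := fun k =>
    ⟨eq ⟨k, by rw [Fintype.card_fin]; omega⟩, by
      rw [Matrix.IsHermitian.eigenvalues, Equiv.symm_apply_apply]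
      refine (hpos.trans_le ((smat_isHermitian X).eigenvalues₀_antitone ?_)).ne'
      rw [Fin.le_def]
      simp only [Fin.val_cast]
      omega⟩
  have hg : Function.Injective g := fun a b hab => by
    have := eq.injective (congrArg Subtype.val hab)
    exact Fin.ext (Fin.mk.inj_iff.1 this)
  have := Fintype.card_le_of_injective g hg
  rw [Fintype.card_fin] at this
  omega

theorem gram_factorOf (hm : m ≤ p) {X : Sym p} (hX : (smat X).PosSemidef)
    (hr : (smat X).rank ≤ m) {P : Matrix (Fin p) (Fin p) ℝ} (hP : P ∈ eigBases X) :
    gram (factorOf hm X P) = X := by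
  refine sym_ext fun i j => ?_
  have h1 : smat (gram (factorOf hm X P)) i j
      = ∑ k : Fin m, eigval X (Fin.castLE hm k) * (P i (Fin.castLE hm k) * P j (Fin.castLE hm k)) := by
    rw [smat_gram, Matrix.mul_apply]
    refine Finset.sum_congr rfl fun k _ => ?_
    rw [factorOf, mat_ofMat, Matrix.transpose_apply, Matrix.diagonal_mul, Matrix.diagonal_mul]
    simp only [Matrix.transpose_apply, Matrix.submatrix_apply, id]
    have := Real.mul_self_sqrt (eigval_nonneg hX (Fin.castLE hm k))
    linear_combination (P i (Fin.castLE hm k) * P j (Fin.castLE hm k)) * this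
  have h2 : smat X i j = ∑ k : Fin p, eigval X k * (P i k * P j k) := by
    rw [hP.2, Matrix.mul_apply]
    refine Finset.sum_congr rfl fun k _ => ?_
    rw [Matrix.mul_diagonal, Matrix.transpose_apply]; ring
  rw [h1, h2]
  refine Fintype.sum_of_injective (Fin.castLE hm) (Fin.castLE_injective hm) _ _ ?_ fun k => rfl
  intro k hk
  have : m ≤ k := by
    by_contra hlt
    exact hk ⟨⟨k, not_le.1 hlt⟩, rfl⟩
  rw [eigval_eq_zero hX hr this, zero_mul]

/-- Normals to `Ω` at `VᵀV` pull back to normals to the unit-column matrices at `V`. -/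
theorem two_smul_mulSym_mem_normalCone {V : RMat m p} {N : Sym p}
    (hN : N ∈ normalCone (Omega p) (gram V)) :
    (2 : ℝ) • mulSym V N ∈ normalCone (unitCols m p) V := by
  have hV : gram V ∈ Omega p := (mem_normalCone_iff.1 hN).1
  refine mem_normalCone_of_eventually_le_sq ((gram_mem_Omega_iff V).1 hV) ‖N‖
    (Eventually.of_forall fun U hU => ?_)
  -- In the exact expansion of `UᵀU` about `V`, the linear term is paired with `2 V N`, and the
  -- remainder costs at most `‖N‖ ‖U - V‖²`.
  have h1 := inner_le_of_mem_normalCone (convex_Omega p) hN ((gram_mem_Omega_iff U).2 hU)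
  have h2 := gram_add V (U - V)
  rw [add_sub_cancel] at h2
  rw [h2, add_assoc, add_sub_cancel_left, inner_add_right, inner_dgram] at h1
  have h3 := (abs_le.1 ((abs_real_inner_le_norm N (gram (U - V))).trans
    (mul_le_mul_of_nonneg_left (norm_gram_le (U - V)) (norm_nonneg N)))).1
  linarith

theorem mem_statFac_of_gram_mem_statPen (hp : 0 < p) {f : Sym p → ℝ} (hf : Differentiable ℝ f) {ρ : ℝ}
    {V : RMat m p} (hV : gram V ∈ statPen f ρ) : V ∈ statFac m f ρ := by
  have hO := mem_Omega_of_mem_statPen hV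
  have hpos := specNorm_pos_of_mem_Omega hp hO
  obtain ⟨W, hW, N, hN, h⟩ := mem_statPen_iff.1 hV
  obtain ⟨u, hu, hue, rfl⟩ := exists_of_mem_limSubdiff_psi hp hO.1 hpos hW
  refine (mem_statFac_iff hf).2 ⟨_, mem_limSubdiff_psiTilde hpos hu hue, _,
    two_smul_mulSym_mem_normalCone hN, ?_⟩
  have h2 := congrArg (fun W => (2 : ℝ) • mulSym V W) h
  have h0 : mulSym V (0 : Sym p) = 0 := by simpa using mulSym_smul V 0 (0 : Sym p)
  simp only [mulSym_add, mulSym_smul, mulSym_idMat, h0, smul_zero] at h2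
  rw [← h2]
  module

theorem exists_multiplier (hp : 0 < p) {f : Sym p → ℝ} (hf : Differentiable ℝ f) {ρ : ℝ}
    {V : RMat m p} (hV : V ∈ statFac m f ρ) :
    ∃ W ∈ limSubdiff psi (gram V), ∃ y : Fin p → ℝ,
      mat V * smat (dualMat f ρ V W y) = 0 := by
  obtain ⟨G, hG, N, hN, h⟩ := (mem_statFac_iff hf).1 hV
  obtain ⟨u, hu, hue, rfl⟩ := exists_of_mem_limSubdiff_psiTilde hp hG
  obtain ⟨z, rfl⟩ := exists_of_mem_normalCone_unitCols hN
  -- The factorized condition carries a factor `2` on all terms but `V Diag z`; halving it gives `y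
  -- = z / 2`.
  refine ⟨-outer u, neg_outer_mem_limSubdiff_psi hu hue, fun j => z j / 2, ?_⟩
  have hz : diagMat (fun j => z j / 2) = (1 / 2 : ℝ) • diagMat z := by
    refine sym_ext fun i j => ?_
    rw [smat_smul, smat_diagMat, smat_diagMat, Matrix.smul_apply, Matrix.diagonal_apply,
      Matrix.diagonal_apply, smul_eq_mul]
    split_ifs <;> ring
  rw [← mat_mulSym]
  have h2 : mulSym V (dualMat f ρ V (-outer u) fun j => z j / 2) = 0 := by
    rw [dualMat, hz]
    simp only [mulSym_add, mulSym_smul, mulSym_idMat]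
    have h' := congrArg (fun A => (1 / 2 : ℝ) • A) h
    simp only [smul_zero] at h'
    rw [← h']
    module
  rw [h2]; rfl

theorem inner_gram_eq (S : Sym p) (V : RMat m p) :
    inner ℝ S (gram V) = inner ℝ (mulSym V S) V := by
  have h : dgram V V = (2 : ℝ) • gram V := by
    refine sym_ext fun i j => ?_
    rw [smat_dgram, smat_smul, smat_gram, two_smul]
  have := inner_dgram S V V
  rw [h, sym_inner_smul_right, real_inner_smul_left] at this
  linarith

open scoped MatrixOrder Matrix.Norms.L2Operator in
theorem exists_gram_eq_of_posSemidef {Z : Sym p} (hZ : (smat Z).PosSemidef) :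
    ∃ B : RMat p p, Z = gram B := by
  obtain ⟨B, hB⟩ := CStarAlgebra.nonneg_iff_eq_star_mul_self.1 hZ.nonneg
  refine ⟨ofMat B, sym_ext fun i j => ?_⟩
  rw [smat_gram, mat_ofMat, hB, Matrix.star_eq_conjTranspose,
    Matrix.conjTranspose_eq_transpose_of_trivial]

/-- Writing `Z = BᵀB`, the inner product is the trace of `B S Bᵀ`. -/
theorem inner_nonneg_of_posSemidef {S Z : Sym p} (hS : (smat S).PosSemidef)
    (hZ : (smat Z).PosSemidef) : 0 ≤ inner ℝ S Z := by
  obtain ⟨B, rfl⟩ := exists_gram_eq_of_posSemidef hZ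
  have hSt : (smat S).transpose = smat S := S.2
  have := (hS.mul_mul_conjTranspose_same (mat B)).trace_nonneg
  rw [Matrix.conjTranspose_eq_transpose_of_trivial, Matrix.mul_assoc, Matrix.trace_mul_comm] at this
  rw [inner_gram_eq, inner_eq_trace, mat_mulSym, Matrix.transpose_mul, hSt]
  exact this

/-- With `S` the dual matrix, the normal vector is `Diag y - S`: the diagonal part is constant on
`Ω`, and `⟨S, Z⟩ ≥ 0 = ⟨S, VᵀV⟩`. -/
theorem gram_mem_statPen {f : Sym p → ℝ} {ρ : ℝ} {V : RMat m p} (hV : gram V ∈ Omega p)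
    {W : Sym p} (hW : W ∈ limSubdiff psi (gram V)) {y : Fin p → ℝ}
    (h0 : mat V * smat (dualMat f ρ V W y) = 0) (hS : (smat (dualMat f ρ V W y)).PosSemidef) :
    gram V ∈ statPen f ρ := by
  refine mem_statPen_iff.2 ⟨W, hW, diagMat y - dualMat f ρ V W y, ?_, by rw [dualMat]; abel⟩
  refine mem_normalCone_of_forall_inner_le hV fun Z hZ => ?_
  have h1 : inner ℝ (dualMat f ρ V W y) (gram V) = 0 := by
    have : mulSym V (dualMat f ρ V W y) = 0 := rmat_ext h0
    rw [inner_gram_eq, this, inner_zero_left]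
  have h2 := inner_nonneg_of_posSemidef hS hZ.1
  rw [inner_sub_left, inner_diagMat_sub hV hZ, inner_sub_right, h1]
  linarith

theorem feasible_eq_statDC (hp : 0 < p) (f : Sym p → ℝ) : feasible p = statDC f := by
  ext X
  simp only [statDC, Set.mem_ofPred_eq, Set.mem_add, Set.mem_singleton_iff]
  constructor
  · exact fun hX => ⟨_, rfl, -∇ f X, normalCone_feasible hp hX _, by abel⟩
  · rintro ⟨_, -, N, hN, -⟩
    exact (mem_normalCone_iff.1 hN).1

theorem feasible_eq_setOf (hp : 0 < p) (f : Sym p → ℝ) :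
    feasible p = {X : Sym p | (0 : Sym p) ∈
      {∇ f X} + normalCone (Omega p) X + normalCone (rankLeOne p) X} := by
  ext X
  simp only [Set.mem_ofPred_eq, Set.mem_add, Set.mem_singleton_iff]
  constructor
  · intro hX
    obtain ⟨x, hx, rfl⟩ := (mem_feasible_iff hp).1 hX
    set A := -∇ f (outer x)
    -- The equation `Diag(y) x = A x` determines `y`, since `xᵢ² = 1`.
    set y : Fin p → ℝ := fun i => opOf A x i * x i
    have hH : opOf (A - diagMat y) x = 0 := by
      rw [opOf_sub, sub_apply, sub_eq_zero]
      ext i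
      rw [opOf_apply (diagMat y), smat_diagMat]
      have : x i * x i = 1 := by rcases hx i with h | h <;> simp [h]
      simp only [Matrix.diagonal_apply, ite_mul, zero_mul, Finset.sum_ite_eq, Finset.mem_univ,
        if_true, y]
      rw [mul_assoc, this, mul_one]
    refine ⟨_, ⟨_, rfl, diagMat y, diagMat_mem_normalCone (outer_mem_Omega hx) y, rfl⟩,
      A - diagMat y, mem_normalCone_rankLeOne hp hx hH, ?_⟩
    simp only [A]
    abel
  · rintro ⟨_, ⟨_, -, N, hN, -⟩, M, hM, -⟩
    exact mem_feasible_of_rank_le_one hp (mem_normalCone_iff.1 hN).1 (mem_normalCone_iff.1 hM).1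

end Stationary

end DCSDP

theorem proposition3p2 (p : ℕ) (hp : 0 < p) (f : DCSDP.Sym p → ℝ) (hf : ContDiff ℝ 1 f)
    (α : ℝ≥0) (hα : LipschitzOnWith α f (DCSDP.Omega p)) :
    -- (i)
    (DCSDP.feasible p = DCSDP.statDC f ∧
      DCSDP.feasible p = {X : DCSDP.Sym p | (0 : DCSDP.Sym p) ∈
        {∇ f X} + DCSDP.normalCone (DCSDP.Omega p) X
          + DCSDP.normalCone (DCSDP.rankLeOne p) X}) ∧
    -- (ii)
    ((∀ ρ : ℝ, 0 < ρ → DCSDP.crit (DCSDP.Phi f ρ) ⊆ DCSDP.statPen f ρ) ∧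
      (∀ ρ : ℝ, 0 < ρ → ∀ X ∈ DCSDP.statPen f ρ, (DCSDP.smat X).rank = 1 →
        ∀ ρ' : ℝ, (1 + 2 * (p : ℝ)) * α < ρ' →
          DCSDP.IsStrictLocalMinimizer (DCSDP.penObj f ρ') (DCSDP.Omega p) X)) ∧
    -- (iii)
    (∀ X ∈ DCSDP.feasible p, ∃ U ∈ 𝓝 X, ∀ ρ : ℝ, (1 + 2 * (p : ℝ)) * α < ρ →
      ∀ Z ∈ DCSDP.statPen f ρ, Z ∈ U →
        (DCSDP.penObj f ρ Z : EReal) ≤ DCSDP.Phi f ρ X → (DCSDP.smat Z).rank = 1) ∧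
    -- (iv)
    (∀ (m : ℕ) (_ : 1 < m) (hmp : m < p) (ρ : ℝ), 0 < ρ →
      (∀ X ∈ DCSDP.statPen f ρ, (DCSDP.smat X).rank ≤ m → ∀ P ∈ DCSDP.eigBases X,
        DCSDP.factorOf hmp.le X P ∈ DCSDP.statFac m f ρ) ∧
      (∀ V ∈ DCSDP.statFac m f ρ,
        -- multiplier pairs `(W, y)` of the stationary point `V` exist,
        (∃ W ∈ DCSDP.limSubdiff DCSDP.psi (DCSDP.gram V), ∃ y : Fin p → ℝ,
          DCSDP.mat V * DCSDP.smat (DCSDP.dualMat f ρ V W y) = 0) ∧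
        -- and if one of them is a positive semidefinite certificate, `VᵀV` is stationary
        ((∃ W ∈ DCSDP.limSubdiff DCSDP.psi (DCSDP.gram V), ∃ y : Fin p → ℝ,
          DCSDP.mat V * DCSDP.smat (DCSDP.dualMat f ρ V W y) = 0 ∧
            (DCSDP.smat (DCSDP.dualMat f ρ V W y)).PosSemidef) →
          DCSDP.gram V ∈ DCSDP.statPen f ρ))) := by

  have hd : Differentiable ℝ f := hf.differentiable one_ne_zero
  refine ⟨⟨DCSDP.feasible_eq_statDC hp f, DCSDP.feasible_eq_setOf hp f⟩,
    ⟨fun ρ hρ => DCSDP.crit_Phi_subset_statPen hp hf hρ, ?_⟩, ?_, ?_⟩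
  · intro ρ _ X hX hr ρ' hρ'
    have hO := DCSDP.mem_Omega_of_mem_statPen hX
    have hF := DCSDP.mem_feasible_of_rank_le_one hp hO hr.le
    refine ⟨hO, ?_⟩
    filter_upwards [DCSDP.eventually_penObj_lt hp hα hF] with Z hZ hZO hne
    exact hZ ρ' hρ' hZO hne
  · intro X hX
    refine ⟨_, DCSDP.eventually_penObj_lt hp hα hX, fun ρ hρ Z hZ hZU hle => ?_⟩
    rw [DCSDP.Phi_of_mem (DCSDP.mem_Omega_of_mem_feasible hX), EReal.coe_le_coe_iff] at hle
    -- Strict minimality of `X` in this neighborhood leaves only `Z = X` at a penalty value no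
    -- larger than that of `X`.
    have hZX : Z = X := by
      by_contra hne
      exact absurd (hZU ρ hρ (DCSDP.mem_Omega_of_mem_statPen hZ) hne) (not_lt.2 hle)
    rw [hZX]
    exact DCSDP.rank_of_mem_feasible hp hX
  · intro m _ hmp ρ _
    refine ⟨fun X hX hr P hP => ?_, fun V hV => ⟨DCSDP.exists_multiplier hp hd hV, ?_⟩⟩
    · refine DCSDP.mem_statFac_of_gram_mem_statPen hp hd ?_
      rwa [DCSDP.gram_factorOf hmp.le (DCSDP.mem_Omega_of_mem_statPen hX).1 hr hP]
    · rintro ⟨W, hW, y, h0, hS⟩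
      obtain ⟨_, _, N, hN, _⟩ := (DCSDP.mem_statFac_iff hd).1 hV
      exact DCSDP.gram_mem_statPen
        ((DCSDP.gram_mem_Omega_iff V).2 (DCSDP.mem_normalCone_iff.1 hN).1) hW h0 hS
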